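/- Let $\mathrm{Diff}^1_0([0,1])$ be the group of orientation-preserving $C^1$ diffeomorphisms of $[0,1]$, and let $\mathrm{Aff}(\mathbb{R})=\{x\mapsto ax+b : a>0,\ b\in\mathbb{R}\}$. An action on an interval is called irreducible if it has no global fixed point in the interior of the interval. Two irreducible actions $\varphi$ and $\psi$ of a group $G$ on open intervals $X$ and $Y$ by orientation-preserving homeomorphisms are semi-conjugate if there is a monotone (non-decreasing or non-increasing, not necessarily continuous) map $h\colon X\to Y$, called a semi-conjugacy, such that $h\circ\varphi(g)=\psi(g)\circ h$ for all $g\in G$; the map $h$ is a topological conjugacy if moreover it is a homeomorphism. Let $G$ be a finitely generated virtually solvable group and let $\varphi\colon G\to \mathrm{Diff}^1_0([0,1])$ be an irreducible action. Then the restriction of $\varphi$ to $(0,1)$ is semi-conjugate to an (irreducible) affine action $\psi\colon G\to\mathrm{Aff}(\mathbb{R})$. Moreover, whenever $h\colon (0,1)\to\mathbb{R}$ is a semi-conjugacy between the restriction of $\varphi$ to $(0,1)$ and an affine action $\psi\colon G\to \mathrm{Aff}(\mathbb{R})$ whose image is non-abelian, $h$ is a topological conjugacy. -/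

import Mathlib

open Set

namespace AffineActions

/-- The group `Homeo₀(X)` of orientation-preserving (that is, strictly increasing)
homeomorphisms of a linearly ordered space `X`; multiplication is composition. -/
def Homeo₀ (X : Type*) [TopologicalSpace X] [LinearOrder X] : Subgroup (X ≃ₜ X) where
  carrier := {f | StrictMono f}
  mul_mem' {f g} hf hg := show StrictMono (fun x => f (g x)) from hf.comp hg
  one_mem' := show StrictMono (fun x : X => x) from strictMono_id
  inv_mem' {f} hf := show StrictMono f.symm from fun x y hxy => by
    have hf' : StrictMono f := hf
    rw [← hf'.lt_iff_lt]
    simpa using hxy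

/-- A self-map of `[0,1]` is of class `C¹`: it is continuously differentiable on the closed
interval (one-sided derivatives at the endpoints). -/
def IsC1 (f : Icc (0 : ℝ) 1 → Icc (0 : ℝ) 1) : Prop :=
  ∃ F : ℝ → ℝ, ContDiffOn ℝ 1 F (Icc 0 1) ∧ ∀ x : Icc (0 : ℝ) 1, F x = f x

theorem IsC1.comp {f g : Icc (0 : ℝ) 1 → Icc (0 : ℝ) 1} (hf : IsC1 f) (hg : IsC1 g) :
    IsC1 (fun x => f (g x)) := by
  obtain ⟨F, hF, hFf⟩ := hf
  obtain ⟨K, hK, hKg⟩ := hg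
  refine ⟨F ∘ K, hF.comp hK fun x hx => ?_, fun x => ?_⟩
  · rw [hKg ⟨x, hx⟩]
    exact (g ⟨x, hx⟩).2
  · rw [Function.comp_apply, hKg x, hFf (g x)]

theorem isC1_id : IsC1 (fun x => x) := ⟨id, contDiffOn_id, fun _ => rfl⟩

/-- The group `Diff¹₀([0,1])` of orientation-preserving `C¹` diffeomorphisms of `[0,1]`:
increasing homeomorphisms that are `C¹` together with their inverse. -/
def Diff₀ : Subgroup (Icc (0 : ℝ) 1 ≃ₜ Icc (0 : ℝ) 1) where
  carrier := {f | StrictMono f ∧ IsC1 f ∧ IsC1 f.symm}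
  mul_mem' {f g} hf hg :=
    ⟨(Homeo₀ _).mul_mem hf.1 hg.1, show IsC1 (fun x => f (g x)) from hf.2.1.comp hg.2.1,
      show IsC1 (fun x => g.symm (f.symm x)) from hg.2.2.comp hf.2.2⟩
  one_mem' := ⟨(Homeo₀ _).one_mem, isC1_id, isC1_id⟩
  inv_mem' {_} hf := ⟨(Homeo₀ _).inv_mem hf.1, hf.2.2, hf.2.1⟩

theorem Diff₀_le_Homeo₀ : Diff₀ ≤ Homeo₀ (Icc (0 : ℝ) 1) := fun _ hf => hf.1

/-- The group `Aff(ℝ)` of maps `x ↦ a x + b` with `a > 0`. -/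
def Aff : Subgroup (ℝ ≃ₜ ℝ) where
  carrier := {f | ∃ a b : ℝ, 0 < a ∧ ∀ x, f x = a * x + b}
  mul_mem' {f g} := by
    rintro ⟨a, b, ha, hf⟩ ⟨c, d, hc, hg⟩
    refine ⟨a * c, a * d + b, mul_pos ha hc, fun x => ?_⟩
    change f (g x) = _
    rw [hg, hf]
    ring
  one_mem' := ⟨1, 0, one_pos, fun x => by change x = _; ring⟩
  inv_mem' {f} := by
    rintro ⟨a, b, ha, hf⟩
    refine ⟨a⁻¹, -(a⁻¹ * b), inv_pos.2 ha, fun x => ?_⟩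
    change f.symm x = _
    apply f.injective
    rw [f.apply_symm_apply, hf]
    field_simp
    ring

theorem Aff_le_Homeo₀ : Aff ≤ Homeo₀ ℝ := by
  rintro f ⟨a, b, ha, hf⟩ x y hxy
  rw [hf, hf]
  have := mul_lt_mul_of_pos_left hxy ha
  linarith

theorem mem_Ioo_of_mem_Homeo₀ {f : Icc (0 : ℝ) 1 ≃ₜ Icc (0 : ℝ) 1}
    (hf : f ∈ Homeo₀ (Icc (0 : ℝ) 1)) (x : Ioo (0 : ℝ) 1) :
    ((f ⟨x, Ioo_subset_Icc_self x.2⟩ : Icc (0 : ℝ) 1) : ℝ) ∈ Ioo (0 : ℝ) 1 := by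
  have hf' : StrictMono f := hf
  constructor
  · have h : (⟨0, by simp⟩ : Icc (0 : ℝ) 1) < ⟨x, Ioo_subset_Icc_self x.2⟩ := x.2.1
    exact lt_of_le_of_lt (f ⟨0, by simp⟩).2.1 (hf' h)
  · have h : (⟨x, Ioo_subset_Icc_self x.2⟩ : Icc (0 : ℝ) 1) < ⟨1, by simp⟩ := x.2.2
    exact lt_of_lt_of_le (hf' h) (f ⟨1, by simp⟩).2.2

/-- Restriction of an increasing homeomorphism of `[0,1]` to `(0,1)`. -/
noncomputable def restrictHomeo (f : Homeo₀ (Icc (0 : ℝ) 1)) : Ioo (0 : ℝ) 1 ≃ₜ Ioo (0 : ℝ) 1 where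
  toFun x := ⟨f.1 ⟨x, Ioo_subset_Icc_self x.2⟩, mem_Ioo_of_mem_Homeo₀ f.2 x⟩
  invFun x := ⟨f.1.symm ⟨x, Ioo_subset_Icc_self x.2⟩,
    mem_Ioo_of_mem_Homeo₀ ((Homeo₀ _).inv_mem f.2) x⟩
  left_inv x := by simp
  right_inv x := by simp
  continuous_toFun := by fun_prop
  continuous_invFun := by fun_prop

/-- The restriction homomorphism `Homeo₀([0,1]) → Homeo₀((0,1))`. -/
noncomputable def restrictInterior : Homeo₀ (Icc (0 : ℝ) 1) →* Homeo₀ (Ioo (0 : ℝ) 1) where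
  toFun f := ⟨restrictHomeo f, fun _ _ hxy => f.2 hxy⟩
  map_one' := rfl
  map_mul' _ _ := rfl

section Actions

variable {G : Type*} [Group G]

/-- The action on `(0,1)` obtained by restricting an action on `[0,1]` by `C¹` diffeomorphisms. -/
noncomputable def restrictAction (φ : G →* Diff₀) : G →* Homeo₀ (Ioo (0 : ℝ) 1) :=
  restrictInterior.comp ((Subgroup.inclusion Diff₀_le_Homeo₀).comp φ)

/-- An affine action, seen as an action on the line by increasing homeomorphisms. -/
noncomputable def affineAction (ψ : G →* Aff) : G →* Homeo₀ ℝ :=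
  (Subgroup.inclusion Aff_le_Homeo₀).comp ψ

variable {X Y : Type*} [TopologicalSpace X] [LinearOrder X] [TopologicalSpace Y] [LinearOrder Y]

/-- An action on an open interval is irreducible if it has no global fixed point. -/
def IsIrreducible (φ : G →* Homeo₀ X) : Prop :=
  ∀ x : X, ∃ g : G, (φ g).1 x ≠ x

/-- An action on `[0,1]` is irreducible if it has no global fixed point in `(0,1)`. -/
def IsIrreducibleIcc (φ : G →* Diff₀) : Prop :=
  ∀ x : Icc (0 : ℝ) 1, (x : ℝ) ∈ Ioo (0 : ℝ) 1 → ∃ g : G, (φ g).1 x ≠ x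

/-- `h` is a semi-conjugacy between the irreducible actions `φ` and `ψ` on open intervals:
a monotone (non-decreasing or non-increasing) equivariant map, not assumed continuous. -/
structure IsSemiconjugacy (φ : G →* Homeo₀ X) (ψ : G →* Homeo₀ Y) (h : X → Y) : Prop where
  irreducible_left : IsIrreducible φ
  irreducible_right : IsIrreducible ψ
  monotone : Monotone h ∨ Antitone h
  equivariant : ∀ (g : G) (x : X), h ((φ g).1 x) = (ψ g).1 (h x)

/-- `h` is a topological conjugacy: a semi-conjugacy which is a homeomorphism. -/
structure IsConjugacy (φ : G →* Homeo₀ X) (ψ : G →* Homeo₀ Y) (h : X → Y) : Prop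
    extends IsSemiconjugacy φ ψ h where
  isHomeomorph : IsHomeomorph h

/-- An affine action is abelian if its image is abelian. -/
def IsAbelianAction (ψ : G →* Aff) : Prop :=
  ∀ f₁ ∈ ψ.range, ∀ f₂ ∈ ψ.range, f₁ * f₂ = f₂ * f₁

end Actions

/-- A group is virtually solvable if it has a solvable subgroup of finite index. -/
def IsVirtuallySolvable (G : Type*) [Group G] : Prop :=
  ∃ H : Subgroup G, H.FiniteIndex ∧ Group.IsSolvable H

end AffineActions

namespace AffineActions

/-! ### Increasing actions on a complete chain -/

section OrderAction

variable {G X : Type*} [Group G] [MulAction G X]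

/-! Take a solvable normal subgroup of finite index and its derived series. The first term with a
fixed point in the interior follows a term N without one. On the closed G-invariant set F of those
fixed points, N acts through an abelian group (`IsVirtuallySolvable.exists_isAbelianOn`).

Suppose some element of N acts freely on F. Then the elements of N with fixed points in F share one,
x₀, and ordering N by the orbit of x₀ gives, as in Hölder's theorem, a translation number τ : N → ℝ
and a monotone k with k(gx) = k(x) + τ(g) for g in N. If N is a commutator subgroup, τ has dense
image, so k is unique up to a constant and G acts on its values affinely. If N has finite index,
averaging k over cosets makes G act by translations (`IsAbelianOn.exists_affine`).

Otherwise every element of N has a fixed point in F. The complementary components of these fixed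
sets (leaves) are nested when they overlap, and finite generation yields t mapping a leaf strictly
over itself. This contradicts C¹ regularity (`IsLeaf.not_expanded`): words of n letters in
conjugates of an element with derivative 1 at a point α fixed by t produce M^n disjoint copies of
the leaf. Moving the leaf close to α costs only an exponential factor, the words shrink it by at
most 2^n more, and a large M makes the total length exceed 1.

For the second claim, a non-abelian affine image contains an expansion t by l > 2 and a commutator
acting as a translation by β, whose derivative at 0 is therefore 1. An interval collapsed by h can
be pushed towards 0, where the 2^n sums of distinct terms β/l^j give disjoint copies of it, each
shrunk by at most (9/10)^(3n); but 2 · (9/10)^3 > 1 (`IsC1Action.strictMonoOn_of_affine`). Small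
translations make the image of h dense, so h is a homeomorphism. -/

theorem smul_le_smul_iff_of_action [Preorder X] [CovariantClass G X (· • ·) (· ≤ ·)]
    (g : G) {x y : X} : g • x ≤ g • y ↔ x ≤ y :=
  ⟨fun h => by simpa using smul_mono_right g⁻¹ h, fun h => smul_mono_right g h⟩

theorem smul_lt_smul_iff_of_action [Preorder X] [CovariantClass G X (· • ·) (· ≤ ·)]
    (g : G) {x y : X} : g • x < g • y ↔ x < y := by
  rw [lt_iff_le_not_ge, lt_iff_le_not_ge, smul_le_smul_iff_of_action, smul_le_smul_iff_of_action]

theorem smul_le_iff_le_inv_smul [Preorder X] [CovariantClass G X (· • ·) (· ≤ ·)]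
    (g : G) {x y : X} : g • x ≤ y ↔ x ≤ g⁻¹ • y := by
  rw [← smul_le_smul_iff_of_action g (y := g⁻¹ • y), smul_inv_smul]

/-- An element of a group acting by increasing maps, as an order isomorphism. -/
def smulOrderIso [Preorder X] [CovariantClass G X (· • ·) (· ≤ ·)] (g : G) : X ≃o X where
  toEquiv := MulAction.toPerm g
  map_rel_iff' := smul_le_smul_iff_of_action g

theorem mem_orbit_image (Γ : Subgroup G) (x : X) : x ∈ (fun f : G => f • x) '' Γ :=
  ⟨1, Γ.one_mem, one_smul _ _⟩

variable [CompleteLinearOrder X] [CovariantClass G X (· • ·) (· ≤ ·)]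

theorem smul_sSup_of_action (g : G) (A : Set X) : g • sSup A = sSup ((g • ·) '' A) :=
  (map_sSup (smulOrderIso (X := X) g) A).trans rfl

theorem smul_sInf_of_action (g : G) (A : Set X) : g • sInf A = sInf ((g • ·) '' A) :=
  (map_sInf (smulOrderIso (X := X) g) A).trans rfl

theorem smul_mem_Ioo (g : G) {x : X} (hx : x ∈ Ioo (⊥ : X) ⊤) : g • x ∈ Ioo (⊥ : X) ⊤ := by
  have h1 : g • (⊥ : X) = ⊥ := map_bot (smulOrderIso (X := X) g)
  have h2 : g • (⊤ : X) = ⊤ := map_top (smulOrderIso (X := X) g)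
  constructor
  · rw [← h1]; exact (smul_lt_smul_iff_of_action g).2 hx.1
  · rw [← h2]; exact (smul_lt_smul_iff_of_action g).2 hx.2

theorem smul_sSup_orbit (Γ : Subgroup G) (x : X) {g : G} (hg : g ∈ Γ) :
    g • sSup ((fun f : G => f • x) '' Γ) = sSup ((fun f : G => f • x) '' Γ) := by
  rw [smul_sSup_of_action]
  congr 1
  ext y
  constructor
  · rintro ⟨_, ⟨f, hf, rfl⟩, rfl⟩
    exact ⟨g * f, Γ.mul_mem hg hf, mul_smul _ _ _⟩
  · rintro ⟨f, hf, rfl⟩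
    exact ⟨_, ⟨g⁻¹ * f, Γ.mul_mem (Γ.inv_mem hg) hf, rfl⟩, by simp [mul_smul]⟩

theorem smul_sInf_orbit (Γ : Subgroup G) (x : X) {g : G} (hg : g ∈ Γ) :
    g • sInf ((fun f : G => f • x) '' Γ) = sInf ((fun f : G => f • x) '' Γ) := by
  rw [smul_sInf_of_action]
  congr 1
  ext y
  constructor
  · rintro ⟨_, ⟨f, hf, rfl⟩, rfl⟩
    exact ⟨g * f, Γ.mul_mem hg hf, mul_smul _ _ _⟩
  · rintro ⟨f, hf, rfl⟩
    exact ⟨_, ⟨g⁻¹ * f, Γ.mul_mem (Γ.inv_mem hg) hf, rfl⟩, by simp [mul_smul]⟩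

/-- A normal subgroup `N` acting through an abelian quotient, and without fixed points, on an
invariant set `F` that is closed under suprema and infima. -/
structure IsAbelianOn (N : Subgroup G) (F : Set X) : Prop where
  normal : N.Normal
  sSup_mem : ∀ A ⊆ F, sSup A ∈ F
  sInf_mem : ∀ A ⊆ F, sInf A ∈ F
  smul_mem : ∀ (g : G), ∀ x ∈ F, g • x ∈ F
  comm : ∀ a ∈ N, ∀ b ∈ N, ∀ x ∈ F, a • b • x = b • a • x
  exists_ne : ∀ x ∈ F, x ∈ Ioo (⊥ : X) ⊤ → ∃ g ∈ N, g • x ≠ x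
  nonempty : ∃ x ∈ F, x ∈ Ioo (⊥ : X) ⊤

/-- The supremum of the orbit lies in F and is fixed by `Γ`; a bound `y < ⊤` on the orbit would make
it an interior fixed point. -/
theorem exists_lt_smul {F : Set X} (Γ : Subgroup G) (hS : ∀ A ⊆ F, sSup A ∈ F)
    (hinv : ∀ g ∈ Γ, ∀ x ∈ F, g • x ∈ F)
    (hne : ∀ x ∈ F, x ∈ Ioo (⊥ : X) ⊤ → ∃ g ∈ Γ, g • x ≠ x) {x y : X} (hxF : x ∈ F)
    (hx : ⊥ < x) (hy : y < ⊤) : ∃ g ∈ Γ, y < g • x := by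
  by_contra! hcon
  have hle : sSup ((fun f : G => f • x) '' Γ) ≤ y := sSup_le (by
    rintro _ ⟨f, hf, rfl⟩; exact hcon f hf)
  obtain ⟨g, hg, hgx⟩ := hne _ (hS ((fun f : G => f • x) '' Γ) (by
    rintro _ ⟨f, hf, rfl⟩; exact hinv f hf x hxF))
    ⟨hx.trans_le (le_sSup (mem_orbit_image Γ x)), hle.trans_lt hy⟩
  exact hgx (smul_sSup_orbit Γ x hg)

theorem exists_smul_lt {F : Set X} (Γ : Subgroup G) (hS : ∀ A ⊆ F, sInf A ∈ F)
    (hinv : ∀ g ∈ Γ, ∀ x ∈ F, g • x ∈ F)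
    (hne : ∀ x ∈ F, x ∈ Ioo (⊥ : X) ⊤ → ∃ g ∈ Γ, g • x ≠ x) {x y : X} (hxF : x ∈ F)
    (hx : x < ⊤) (hy : ⊥ < y) : ∃ g ∈ Γ, g • x < y := by
  by_contra! hcon
  have hle : y ≤ sInf ((fun f : G => f • x) '' Γ) := le_sInf (by
    rintro _ ⟨f, hf, rfl⟩; exact hcon f hf)
  obtain ⟨g, hg, hgx⟩ := hne _ (hS ((fun f : G => f • x) '' Γ) (by
    rintro _ ⟨f, hf, rfl⟩; exact hinv f hf x hxF))
    ⟨hy.trans_le hle, (sInf_le (mem_orbit_image Γ x)).trans_lt hx⟩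
  exact hgx (smul_sInf_orbit Γ x hg)

variable {N : Subgroup G} {F : Set X}

theorem IsAbelianOn.exists_lt_zpow_smul (hNF : IsAbelianOn N F) {a : G}
    (ha : ∀ x ∈ F, x ∈ Ioo (⊥ : X) ⊤ → a • x ≠ x) {x y : X} (hxF : x ∈ F)
    (hx : ⊥ < x) (hy : y < ⊤) : ∃ n : ℤ, y < a ^ n • x := by
  obtain ⟨_, ⟨n, rfl⟩, h⟩ := exists_lt_smul (Subgroup.zpowers a) hNF.sSup_mem
    (fun g _ => hNF.smul_mem g) (fun x h1 h2 => ⟨a, Subgroup.mem_zpowers a, ha x h1 h2⟩) hxF hx hy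
  exact ⟨n, h⟩

theorem IsAbelianOn.exists_zpow_smul_lt (hNF : IsAbelianOn N F) {a : G}
    (ha : ∀ x ∈ F, x ∈ Ioo (⊥ : X) ⊤ → a • x ≠ x) {x y : X} (hxF : x ∈ F)
    (hx : x < ⊤) (hy : ⊥ < y) : ∃ n : ℤ, a ^ n • x < y := by
  obtain ⟨_, ⟨n, rfl⟩, h⟩ := exists_smul_lt (Subgroup.zpowers a) hNF.sInf_mem
    (fun g _ => hNF.smul_mem g) (fun x h1 h2 => ⟨a, Subgroup.mem_zpowers a, ha x h1 h2⟩) hxF hx hy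
  exact ⟨n, h⟩

theorem strictMono_zpow_smul {a : G} {p : X} (hp : p < a • p) :
    StrictMono fun n : ℤ => a ^ n • p := by
  refine strictMono_int_of_lt_succ fun n => ?_
  rw [zpow_add_one, mul_smul]
  exact (smul_lt_smul_iff_of_action _).2 hp

theorem IsAbelianOn.exists_zpow_smul_le_lt (hNF : IsAbelianOn N F) {a : G}
    (ha : ∀ x ∈ F, x ∈ Ioo (⊥ : X) ⊤ → a • x ≠ x) {p x : X} (hpF : p ∈ F)
    (hp : p ∈ Ioo (⊥ : X) ⊤) (hap : p < a • p) (hx : x ∈ Ioo (⊥ : X) ⊤) :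
    ∃ n : ℤ, a ^ n • p ≤ x ∧ x < a ^ (n + 1) • p := by
  obtain ⟨k, hk⟩ := hNF.exists_lt_zpow_smul ha hpF hp.1 hx.2
  obtain ⟨l, hl⟩ := hNF.exists_zpow_smul_lt ha hpF hp.2 hx.1
  have hm := strictMono_zpow_smul hap
  obtain ⟨n, hn, hn'⟩ := Int.exists_greatest_of_bdd (P := fun n : ℤ => a ^ n • p ≤ x)
    ⟨k, fun z hz => (hm.lt_iff_lt.1 (hz.trans_lt hk)).le⟩ ⟨l, hl.le⟩
  refine ⟨n, hn, ?_⟩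
  by_contra! h
  have := hn' _ h
  omega

/-- The fundamental domains [aⁿp, aⁿ⁺¹p) cover the whole interior, so freeness on F alone makes `a`
move every interior point upwards, in F or not. -/
theorem IsAbelianOn.lt_smul (hNF : IsAbelianOn N F) {a : G}
    (ha : ∀ x ∈ F, x ∈ Ioo (⊥ : X) ⊤ → a • x ≠ x) {p x : X} (hpF : p ∈ F)
    (hp : p ∈ Ioo (⊥ : X) ⊤) (hap : p < a • p) (hx : x ∈ Ioo (⊥ : X) ⊤) : x < a • x := by
  obtain ⟨n, h1, h2⟩ := hNF.exists_zpow_smul_le_lt ha hpF hp hap hx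
  refine h2.trans_le ?_
  rw [add_comm, zpow_add, zpow_one, mul_smul]
  exact smul_mono_right a h1

end OrderAction

/-! ### Common fixed points and Hölder's theorem -/

section OrderAction

variable {G X : Type*} [Group G] [MulAction G X]
variable [CompleteLinearOrder X] [CovariantClass G X (· • ·) (· ≤ ·)]
variable {N : Subgroup G} {F : Set X}

/-- By commutation the h-orbit of a g-fixed point consists of g-fixed points. It is bounded by an
h-fixed point beyond it, obtained by moving `q` with a power of `a`, so its supremum is interior and
fixed by both. -/
theorem IsAbelianOn.exists_common_fixed (hNF : IsAbelianOn N F) {g h : G} (hg : g ∈ N) (hh : h ∈ N)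
    (hgx : ∃ x ∈ F, x ∈ Ioo (⊥ : X) ⊤ ∧ g • x = x)
    (hhx : ∃ x ∈ F, x ∈ Ioo (⊥ : X) ⊤ ∧ h • x = x) {a : G} (haN : a ∈ N)
    (ha : ∀ x ∈ F, x ∈ Ioo (⊥ : X) ⊤ → a • x ≠ x) :
    ∃ x ∈ F, x ∈ Ioo (⊥ : X) ⊤ ∧ g • x = x ∧ h • x = x := by
  obtain ⟨x, hxF, hx, hgx⟩ := hgx
  obtain ⟨q, hqF, hq, hhq⟩ := hhx
  obtain ⟨n, hn⟩ := hNF.exists_lt_zpow_smul ha hqF hq.1 hx.2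
  set q' := a ^ n • q
  have hq' : q' ∈ Ioo (⊥ : X) ⊤ := smul_mem_Ioo _ hq
  have hhq' : h • q' = q' := by
    rw [hNF.comm h hh _ (N.zpow_mem haN n) q hqF, hhq]
  have hst : ∀ f ∈ Subgroup.zpowers h, f • q' = q' := by
    intro f hf
    have : Subgroup.zpowers h ≤ MulAction.stabilizer G q' := by
      rw [Subgroup.zpowers_le]; exact hhq'
    exact this hf
  have hle : sSup ((fun f : G => f • x) '' Subgroup.zpowers h) ≤ q' := sSup_le (by
    rintro _ ⟨f, hf, rfl⟩
    rw [← hst f hf]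
    exact smul_mono_right f hn.le)
  refine ⟨sSup ((fun f : G => f • x) '' Subgroup.zpowers h), hNF.sSup_mem _ ?_, ⟨?_, ?_⟩, ?_, ?_⟩
  · rintro _ ⟨f, hf, rfl⟩; exact hNF.smul_mem f x hxF
  · exact hx.1.trans_le (le_sSup (mem_orbit_image _ x))
  · exact hle.trans_lt hq'.2
  · rw [smul_sSup_of_action, image_image]
    congr 1
    refine image_congr fun f hf => ?_
    have hfN : f ∈ N := (Subgroup.zpowers_le.2 hh) hf
    rw [hNF.comm g hg f hfN x hxF, hgx]
  · exact smul_sSup_orbit _ x (Subgroup.mem_zpowers h)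

/-- If some element of `N` has no fixed point in `F`, then the elements of `N` that have
a fixed point in `F` have a common one. -/
theorem IsAbelianOn.exists_fixed_of_fixed (hNF : IsAbelianOn N F) {a : G} (haN : a ∈ N)
    (ha : ∀ x ∈ F, x ∈ Ioo (⊥ : X) ⊤ → a • x ≠ x) :
    ∃ x₀ ∈ F, x₀ ∈ Ioo (⊥ : X) ⊤ ∧
      ∀ g ∈ N, (∃ x ∈ F, x ∈ Ioo (⊥ : X) ⊤ ∧ g • x = x) → g • x₀ = x₀ := by
  obtain ⟨p, hpF, hp⟩ := hNF.nonempty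
  wlog hap : p < a • p generalizing a
  · refine this (N.inv_mem haN) (fun x hxF hx h => ha x hxF hx ?_) ?_
    · rw [inv_smul_eq_iff] at h; exact h.symm
    · rw [← smul_lt_smul_iff_of_action a, smul_inv_smul]
      exact lt_of_le_of_ne (not_lt.1 hap) (ha p hpF hp)
  set Z : Set G := {g | g ∈ N ∧ ∃ x ∈ F, x ∈ Ioo (⊥ : X) ⊤ ∧ g • x = x} with hZ
  -- An element fixing q fixes all aⁿq. As p lies between two consecutive ones, it moves p by less
  -- than one step of `a`; this bounds the Z-orbit of p.
  have hbd : ∀ g ∈ Z, g • p ≤ a • p := by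
    rintro g ⟨hgN, q, hqF, hq, hgq⟩
    have haq := hNF.lt_smul ha hpF hp hap hq
    obtain ⟨n, h1, h2⟩ := hNF.exists_zpow_smul_le_lt ha hqF hq haq hp
    calc g • p ≤ g • a ^ (n + 1) • q := smul_mono_right g h2.le
      _ = a ^ (n + 1) • q := by rw [hNF.comm g hgN _ (N.zpow_mem haN _) q hqF, hgq]
      _ = a • a ^ n • q := by rw [add_comm, zpow_add, zpow_one, mul_smul]
      _ ≤ a • p := smul_mono_right a h1
  have hmul : ∀ g ∈ Z, ∀ h ∈ Z, g * h ∈ Z := by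
    rintro g ⟨hgN, hgx⟩ h ⟨hhN, hhx⟩
    obtain ⟨x, hxF, hx, h1, h2⟩ := hNF.exists_common_fixed hgN hhN hgx hhx haN ha
    exact ⟨N.mul_mem hgN hhN, x, hxF, hx, by rw [mul_smul, h2, h1]⟩
  have hinv : ∀ g ∈ Z, g⁻¹ ∈ Z := by
    rintro g ⟨hgN, x, hxF, hx, hgx⟩
    exact ⟨N.inv_mem hgN, x, hxF, hx, by rw [inv_smul_eq_iff, hgx]⟩
  have hone : (1 : G) ∈ Z := ⟨N.one_mem, p, hpF, hp, one_smul _ _⟩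
  set x₀ := sSup ((fun g : G => g • p) '' Z)
  have hle : ∀ g ∈ Z, g • x₀ ≤ x₀ := by
    intro g hg
    rw [smul_sSup_of_action]
    refine sSup_le ?_
    rintro _ ⟨_, ⟨f, hf, rfl⟩, rfl⟩
    exact le_sSup ⟨g * f, hmul g hg f hf, mul_smul _ _ _⟩
  refine ⟨x₀, hNF.sSup_mem _ ?_, ⟨?_, ?_⟩, fun g hgN hgx => ?_⟩
  · rintro _ ⟨f, hf, rfl⟩; exact hNF.smul_mem f p hpF
  · exact hp.1.trans_le (le_sSup ⟨1, hone, one_smul _ _⟩)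
  · refine lt_of_le_of_lt (sSup_le ?_) (smul_mem_Ioo a hp).2
    rintro _ ⟨f, hf, rfl⟩; exact hbd f hf
  · refine le_antisymm (hle g ⟨hgN, hgx⟩) ?_
    have := hle _ (hinv g ⟨hgN, hgx⟩)
    rwa [smul_le_iff_le_inv_smul, inv_inv] at this

/-- A translation number for `N`, relative to the base point `x₀`. -/
structure IsTranslation (N : Subgroup G) (x₀ : X) (τ : G → ℝ) : Prop where
  map_mul : ∀ g ∈ N, ∀ h ∈ N, τ (g * h) = τ g + τ h
  pos_iff : ∀ g ∈ N, 0 < τ g ↔ x₀ < g • x₀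

/-- Hölder's argument: evaluation at x₀ orders the abelian quotient of N by the stabilizer of x₀,
and the order is Archimedean, hence embeds in ℝ. -/
theorem IsAbelianOn.exists_isTranslation (hNF : IsAbelianOn N F) {x₀ : X}
    (hx₀F : x₀ ∈ F) (hx₀ : x₀ ∈ Ioo (⊥ : X) ⊤)
    (hfix : ∀ g ∈ N, (∃ x ∈ F, x ∈ Ioo (⊥ : X) ⊤ ∧ g • x = x) → g • x₀ = x₀) :
    ∃ τ : G → ℝ, IsTranslation N x₀ τ := by
  classical
  have hnorm : (MulAction.stabilizer N x₀).Normal := by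
    refine ⟨fun g hg b => ?_⟩
    rw [MulAction.mem_stabilizer_iff] at hg ⊢
    have hg' : (g : G) • x₀ = x₀ := hg
    have h := hNF.comm g g.2 b⁻¹ (N.inv_mem b.2) x₀ hx₀F
    change ((b * g * b⁻¹ : N) : G) • x₀ = x₀
    simp only [Subgroup.coe_mul, mul_smul, InvMemClass.coe_inv]
    rw [h, hg', smul_inv_smul]
  let Q := N ⧸ MulAction.stabilizer N x₀
  let ev : Q → X := MulAction.ofQuotientStabilizer N x₀
  have hev : ∀ g : N, ev (QuotientGroup.mk g) = (g : G) • x₀ := fun g => rfl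
  have hev1 : ev 1 = x₀ := (hev 1).trans (one_smul G x₀)
  have hinj : Function.Injective ev := MulAction.injective_ofQuotientStabilizer N x₀
  let : CommGroup Q := { (inferInstance : Group Q) with
    mul_comm := by
      intro q r
      induction q using QuotientGroup.induction_on with | _ g => ?_
      induction r using QuotientGroup.induction_on with | _ h => ?_
      apply hinj
      rw [← QuotientGroup.mk_mul, ← QuotientGroup.mk_mul, hev, hev, Subgroup.coe_mul,
        Subgroup.coe_mul, mul_smul, mul_smul]
      exact hNF.comm g g.2 h h.2 x₀ hx₀F }
  let : LinearOrder Q := LinearOrder.lift' ev hinj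
  have hle : ∀ q r : Q, q ≤ r ↔ ev q ≤ ev r := fun _ _ => Iff.rfl
  have hord : ∀ q r : Q, q ≤ r → ∀ s : Q, q * s ≤ r * s := by
    intro q r hqr s
    induction q using QuotientGroup.induction_on with | _ g => ?_
    induction r using QuotientGroup.induction_on with | _ h => ?_
    induction s using QuotientGroup.induction_on with | _ f => ?_
    rw [hle, hev, hev] at hqr
    rw [mul_comm, mul_comm (QuotientGroup.mk h), ← QuotientGroup.mk_mul, ← QuotientGroup.mk_mul,
      hle, hev, hev, Subgroup.coe_mul,
      Subgroup.coe_mul, mul_smul, mul_smul]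
    exact smul_mono_right _ hqr
  have : IsOrderedMonoid Q := { mul_le_mul_left := hord }
  have : Archimedean (Additive Q) := by
    refine ⟨fun u v hv => ?_⟩
    obtain ⟨q, rfl⟩ := Additive.ofMul.surjective u
    obtain ⟨r, rfl⟩ := Additive.ofMul.surjective v
    induction q using QuotientGroup.induction_on with | _ g => ?_
    induction r using QuotientGroup.induction_on with | _ h => ?_
    have hlt : x₀ < (h : G) • x₀ := by
      have : (1 : Q) < QuotientGroup.mk h := hv
      rwa [← not_le, hle, hev, hev1, not_le] at this
    -- A positive element moves x₀, so by the choice of x₀ it has no fixed point in F and its powers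
    -- are cofinal.
    have hfree : ∀ x ∈ F, x ∈ Ioo (⊥ : X) ⊤ → (h : G) • x ≠ x := fun x hxF hx hne =>
      hlt.ne' (hfix h h.2 ⟨x, hxF, hx, hne⟩)
    obtain ⟨n, hn⟩ := hNF.exists_lt_zpow_smul hfree hx₀F hx₀.1 (smul_mem_Ioo (g : G) hx₀).2
    refine ⟨n.toNat, ?_⟩
    have key : (QuotientGroup.mk g : Q) ≤ (QuotientGroup.mk h : Q) ^ n.toNat := by
      rw [← QuotientGroup.mk_pow, hle, hev, hev, Subgroup.coe_pow, ← zpow_natCast]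
      exact hn.le.trans ((strictMono_zpow_smul hlt).monotone (Int.self_le_toNat n))
    exact key
  obtain ⟨f, hf⟩ := Archimedean.exists_orderAddMonoidHom_real_injective (Additive Q)
  have hfm : StrictMono f := f.monotone'.strictMono_of_injective hf
  -- The value 0 off N is arbitrary: `IsTranslation` constrains τ only on N.
  refine ⟨fun g => if hg : g ∈ N then f (Additive.ofMul (QuotientGroup.mk ⟨g, hg⟩ : Q)) else 0,
    fun g hg h hh => ?_, fun g hg => ?_⟩
  · rw [dif_pos hg, dif_pos hh, dif_pos (N.mul_mem hg hh), ← map_add]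
    rfl
  · rw [dif_pos hg, ← map_zero f, hfm.lt_iff_lt]
    have : (0 : Additive Q) < Additive.ofMul (QuotientGroup.mk ⟨g, hg⟩ : Q) ↔
      (1 : Q) < QuotientGroup.mk ⟨g, hg⟩ := Iff.rfl
    rw [this, ← not_le, hle, hev, hev1, not_le]

end OrderAction

/-! ### The monotone map of a translation number -/

section Translation

variable {G X : Type*} [Group G] [MulAction G X]
variable [CompleteLinearOrder X] [CovariantClass G X (· • ·) (· ≤ ·)]
variable {N : Subgroup G} {F : Set X} {x₀ : X} {τ : G → ℝ}

theorem map_one_of_map_mul (hτ : ∀ g ∈ N, ∀ h ∈ N, τ (g * h) = τ g + τ h) : τ 1 = 0 := by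
  have := hτ 1 N.one_mem 1 N.one_mem
  rw [mul_one] at this
  linarith

theorem map_inv_of_map_mul (hτ : ∀ g ∈ N, ∀ h ∈ N, τ (g * h) = τ g + τ h) {g : G} (hg : g ∈ N) :
    τ g⁻¹ = -τ g := by
  have := hτ g hg g⁻¹ (N.inv_mem hg)
  rw [mul_inv_cancel, map_one_of_map_mul hτ] at this
  linarith

theorem map_zpow_of_map_mul (hτ : ∀ g ∈ N, ∀ h ∈ N, τ (g * h) = τ g + τ h) {g : G} (hg : g ∈ N)
    (n : ℤ) : τ (g ^ n) = n * τ g := by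
  induction n with
  | zero => simp [map_one_of_map_mul hτ]
  | succ n ih =>
    rw [zpow_add_one, hτ _ (N.zpow_mem hg _) _ hg, ih]
    push_cast; ring
  | pred n ih =>
    rw [zpow_sub_one, hτ _ (N.zpow_mem hg _) _ (N.inv_mem hg), ih, map_inv_of_map_mul hτ hg]
    push_cast; ring

/-- A homomorphism to the reals is determined up to a factor by its positive elements. -/
theorem eq_mul_of_pos_imp_pos {σ : G → ℝ} (hτ : ∀ g ∈ N, ∀ h ∈ N, τ (g * h) = τ g + τ h)
    (hσ : ∀ g ∈ N, ∀ h ∈ N, σ (g * h) = σ g + σ h) (hpos : ∀ g ∈ N, 0 < τ g → 0 < σ g)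
    {a : G} (ha : a ∈ N) (hτa : 0 < τ a) : ∀ g ∈ N, σ g = σ a / τ a * τ g := by
  have hσa := hpos a ha hτa
  have key : ∀ g ∈ N, σ g / σ a ≤ τ g / τ a := by
    intro g hg
    by_contra! hlt
    -- For r = num/den between the two ratios, a^num · g^(-den) is positive for τ but negative for
    -- σ.
    obtain ⟨r, hr1, hr2⟩ := exists_rat_btwn hlt
    have hd : (0 : ℝ) < (r.den : ℝ) := by exact_mod_cast r.den_pos
    have hr : (r : ℝ) = r.num / r.den := by exact_mod_cast (Rat.num_div_den r).symm
    rw [hr, div_lt_div_iff₀ hτa hd] at hr1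
    rw [hr, div_lt_div_iff₀ hd hσa] at hr2
    have hmem : a ^ r.num * (g ^ (r.den : ℤ))⁻¹ ∈ N :=
      N.mul_mem (N.zpow_mem ha _) (N.inv_mem (N.zpow_mem hg _))
    have h := hpos _ hmem (by
      rw [hτ _ (N.zpow_mem ha _) _ (N.inv_mem (N.zpow_mem hg _)),
        map_inv_of_map_mul hτ (N.zpow_mem hg _), map_zpow_of_map_mul hτ ha,
        map_zpow_of_map_mul hτ hg]
      push_cast; linarith)
    rw [hσ _ (N.zpow_mem ha _) _ (N.inv_mem (N.zpow_mem hg _)),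
      map_inv_of_map_mul hσ (N.zpow_mem hg _), map_zpow_of_map_mul hσ ha,
      map_zpow_of_map_mul hσ hg] at h
    push_cast at h
    linarith
  intro g hg
  have h1 := key g hg
  have h2 := key g⁻¹ (N.inv_mem hg)
  rw [map_inv_of_map_mul hσ hg, map_inv_of_map_mul hτ hg, neg_div, neg_div, neg_le_neg_iff] at h2
  have h3 := le_antisymm h1 h2
  rw [div_eq_iff hσa.ne'] at h3
  rw [h3]; ring

namespace IsTranslation

theorem lt_iff (hτ : IsTranslation N x₀ τ) {g h : G} (hg : g ∈ N) (hh : h ∈ N) :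
    τ g < τ h ↔ g • x₀ < h • x₀ := by
  have := hτ.pos_iff (g⁻¹ * h) (N.mul_mem (N.inv_mem hg) hh)
  rw [hτ.map_mul _ (N.inv_mem hg) _ hh, map_inv_of_map_mul hτ.map_mul hg] at this
  rw [← smul_lt_smul_iff_of_action g⁻¹ (x := g • x₀), inv_smul_smul, ← mul_smul, ← this]
  constructor <;> intro h <;> linarith

theorem le_iff (hτ : IsTranslation N x₀ τ) {g h : G} (hg : g ∈ N) (hh : h ∈ N) :
    τ g ≤ τ h ↔ g • x₀ ≤ h • x₀ := by
  rw [← not_lt, hτ.lt_iff hh hg, not_lt]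

end IsTranslation

/-- The monotone map attached to a translation number. -/
noncomputable def translationMap (N : Subgroup G) (x₀ : X) (τ : G → ℝ) (x : X) : ℝ :=
  sSup (τ '' {g | g ∈ N ∧ g • x₀ ≤ x})

theorem IsAbelianOn.exists_smul_le (hNF : IsAbelianOn N F) (hx₀F : x₀ ∈ F)
    (hx₀ : x₀ ∈ Ioo (⊥ : X) ⊤) {x : X} (hx : x ∈ Ioo (⊥ : X) ⊤) :
    (τ '' {g | g ∈ N ∧ g • x₀ ≤ x}).Nonempty := by
  obtain ⟨g, hg, h⟩ := exists_smul_lt N hNF.sInf_mem (fun g _ => hNF.smul_mem g) hNF.exists_ne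
    hx₀F hx₀.2 hx.1
  exact ⟨_, g, ⟨hg, h.le⟩, rfl⟩

theorem IsAbelianOn.bddAbove_translation (hNF : IsAbelianOn N F) (hx₀F : x₀ ∈ F)
    (hx₀ : x₀ ∈ Ioo (⊥ : X) ⊤) (hτ : IsTranslation N x₀ τ) {x : X} (hx : x ∈ Ioo (⊥ : X) ⊤) :
    BddAbove (τ '' {g | g ∈ N ∧ g • x₀ ≤ x}) := by
  obtain ⟨g, hg, h⟩ := exists_lt_smul N hNF.sSup_mem (fun g _ => hNF.smul_mem g) hNF.exists_ne
    hx₀F hx₀.1 hx.2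
  refine ⟨τ g, ?_⟩
  rintro _ ⟨f, ⟨hf, hfx⟩, rfl⟩
  exact (hτ.le_iff hf hg).2 (hfx.trans h.le)

theorem IsAbelianOn.monotoneOn_translationMap (hNF : IsAbelianOn N F) (hx₀F : x₀ ∈ F)
    (hx₀ : x₀ ∈ Ioo (⊥ : X) ⊤) (hτ : IsTranslation N x₀ τ) :
    MonotoneOn (translationMap N x₀ τ) (Ioo ⊥ ⊤) := by
  intro x hx y hy hxy
  refine csSup_le_csSup (hNF.bddAbove_translation hx₀F hx₀ hτ hy) (hNF.exists_smul_le hx₀F hx₀ hx)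
    (image_mono ?_)
  rintro g ⟨h1, h2⟩
  exact ⟨h1, h2.trans hxy⟩

theorem IsAbelianOn.le_translationMap (hNF : IsAbelianOn N F) (hx₀F : x₀ ∈ F)
    (hx₀ : x₀ ∈ Ioo (⊥ : X) ⊤) (hτ : IsTranslation N x₀ τ) {x : X} (hx : x ∈ Ioo (⊥ : X) ⊤)
    {g : G} (hg : g ∈ N) (hgx : g • x₀ ≤ x) : τ g ≤ translationMap N x₀ τ x :=
  le_csSup (hNF.bddAbove_translation hx₀F hx₀ hτ hx) ⟨g, ⟨hg, hgx⟩, rfl⟩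

theorem IsAbelianOn.translationMap_smul (hNF : IsAbelianOn N F) (hx₀F : x₀ ∈ F)
    (hx₀ : x₀ ∈ Ioo (⊥ : X) ⊤) (hτ : IsTranslation N x₀ τ) {x : X} (hx : x ∈ Ioo (⊥ : X) ⊤)
    {g : G} (hg : g ∈ N) :
    translationMap N x₀ τ (g • x) = translationMap N x₀ τ x + τ g := by
  have key : ∀ g ∈ N, ∀ x ∈ Ioo (⊥ : X) ⊤,
      translationMap N x₀ τ (g • x) ≤ translationMap N x₀ τ x + τ g := by
    intro g hg x hx
    refine csSup_le (hNF.exists_smul_le hx₀F hx₀ (smul_mem_Ioo g hx)) ?_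
    rintro _ ⟨f, ⟨hf, hfx⟩, rfl⟩
    have := hNF.le_translationMap hx₀F hx₀ hτ hx (N.mul_mem (N.inv_mem hg) hf)
      (by rw [mul_smul, smul_le_iff_le_inv_smul, inv_inv]; exact hfx)
    rw [hτ.map_mul _ (N.inv_mem hg) _ hf, map_inv_of_map_mul hτ.map_mul hg] at this
    linarith
  refine le_antisymm (key g hg x hx) ?_
  have := key g⁻¹ (N.inv_mem hg) (g • x) (smul_mem_Ioo g hx)
  rw [inv_smul_smul, map_inv_of_map_mul hτ.map_mul hg] at this
  linarith

/-- Uniqueness, the source of all affinity: on the orbit of x₀ the values of k are forced, and since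
they are dense, monotonicity determines k elsewhere. -/
theorem IsAbelianOn.eq_add_translationMap (hNF : IsAbelianOn N F) (hx₀F : x₀ ∈ F)
    (hx₀ : x₀ ∈ Ioo (⊥ : X) ⊤) (hτ : IsTranslation N x₀ τ) (hd : Dense (τ '' N))
    {k : X → ℝ} (hk : MonotoneOn k (Ioo ⊥ ⊤))
    (hkτ : ∀ g ∈ N, ∀ x ∈ Ioo (⊥ : X) ⊤, k (g • x) = k x + τ g) {x : X}
    (hx : x ∈ Ioo (⊥ : X) ⊤) : k x = k x₀ + translationMap N x₀ τ x := by
  refine le_antisymm ?_ ?_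
  · by_contra! hlt
    obtain ⟨_, ⟨g, hg, rfl⟩, h1, h2⟩ := hd.exists_between (lt_sub_iff_add_lt'.2 hlt)
    have hgx : x ≤ g • x₀ := by
      by_contra! h
      exact h1.not_ge (hNF.le_translationMap hx₀F hx₀ hτ hx hg h.le)
    have := hk hx (smul_mem_Ioo g hx₀) hgx
    rw [hkτ g hg x₀ hx₀] at this
    linarith
  · rw [← le_sub_iff_add_le']
    refine csSup_le (hNF.exists_smul_le hx₀F hx₀ hx) ?_
    rintro _ ⟨f, ⟨hf, hfx⟩, rfl⟩
    have := hk (smul_mem_Ioo f hx₀) hx hfx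
    rw [hkτ f hf x₀ hx₀] at this
    linarith

theorem IsAbelianOn.lt_smul_of_pos (hNF : IsAbelianOn N F) (hx₀F : x₀ ∈ F)
    (hx₀ : x₀ ∈ Ioo (⊥ : X) ⊤) (hτ : IsTranslation N x₀ τ)
    (hfix : ∀ g ∈ N, (∃ x ∈ F, x ∈ Ioo (⊥ : X) ⊤ ∧ g • x = x) → g • x₀ = x₀)
    {g : G} (hg : g ∈ N) (hpos : 0 < τ g) {x : X} (hx : x ∈ Ioo (⊥ : X) ⊤) : x < g • x := by
  have h := (hτ.pos_iff g hg).1 hpos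
  exact hNF.lt_smul (fun y hyF hy hgy => h.ne' (hfix g hg ⟨y, hyF, hy, hgy⟩)) hx₀F hx₀ h hx

/-- Positive elements move every interior point up, a property stable under conjugation. So τ and
its conjugate have compatible positive cones and are proportional. -/
theorem IsAbelianOn.exists_translation_conj (hNF : IsAbelianOn N F) (hx₀F : x₀ ∈ F)
    (hx₀ : x₀ ∈ Ioo (⊥ : X) ⊤) (hτ : IsTranslation N x₀ τ)
    (hfix : ∀ g ∈ N, (∃ x ∈ F, x ∈ Ioo (⊥ : X) ⊤ ∧ g • x = x) → g • x₀ = x₀)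
    {a : G} (ha : a ∈ N) (hτa : 0 < τ a) (f : G) :
    ∃ l : ℝ, 0 < l ∧ ∀ g ∈ N, τ (f * g * f⁻¹) = l * τ g := by
  have hN := hNF.normal
  have hpos : ∀ g ∈ N, 0 < τ g → 0 < τ (f * g * f⁻¹) := by
    intro g hg h
    rw [hτ.pos_iff _ (hN.conj_mem g hg f), mul_smul, mul_smul]
    have := hNF.lt_smul_of_pos hx₀F hx₀ hτ hfix hg h (smul_mem_Ioo f⁻¹ hx₀)
    rwa [← smul_lt_smul_iff_of_action f, smul_inv_smul] at this
  refine ⟨τ (f * a * f⁻¹) / τ a, div_pos (hpos a ha hτa) hτa, fun g hg => ?_⟩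
  refine eq_mul_of_pos_imp_pos (σ := fun g => τ (f * g * f⁻¹)) hτ.map_mul ?_ hpos ha hτa g hg
  intro g hg h hh
  rw [← hτ.map_mul _ (hN.conj_mem g hg f) _ (hN.conj_mem h hh f)]
  congr 1
  group

/-- After division by the multiplier l of f, the map x ↦ k(f x) has the same N-equivariance as k, so
uniqueness applies. -/
theorem IsAbelianOn.exists_affine_of_dense (hNF : IsAbelianOn N F) (hx₀F : x₀ ∈ F)
    (hx₀ : x₀ ∈ Ioo (⊥ : X) ⊤) (hτ : IsTranslation N x₀ τ)
    (hfix : ∀ g ∈ N, (∃ x ∈ F, x ∈ Ioo (⊥ : X) ⊤ ∧ g • x = x) → g • x₀ = x₀)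
    {a : G} (ha : a ∈ N) (hτa : 0 < τ a) (hd : Dense (τ '' N)) (f : G) :
    ∃ l : ℝ, 0 < l ∧ ∃ c : ℝ, ∀ x ∈ Ioo (⊥ : X) ⊤,
      translationMap N x₀ τ (f • x) = l * translationMap N x₀ τ x + c := by
  have hN := hNF.normal
  obtain ⟨l, hl, h⟩ := hNF.exists_translation_conj hx₀F hx₀ hτ hfix ha hτa f
  have hmono := hNF.monotoneOn_translationMap hx₀F hx₀ hτ
  have := fun x hx => hNF.eq_add_translationMap hx₀F hx₀ hτ hd
    (k := fun x => l⁻¹ * translationMap N x₀ τ (f • x)) (x := x)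
    (fun x hx y hy hxy => mul_le_mul_of_nonneg_left
      (hmono (smul_mem_Ioo f hx) (smul_mem_Ioo f hy) (smul_mono_right f hxy)) (inv_pos.2 hl).le)
    (fun g hg x hx => by
      have h1 : f • g • x = (f * g * f⁻¹) • f • x := by simp [mul_smul]
      change l⁻¹ * translationMap N x₀ τ (f • g • x) = _
      rw [h1, hNF.translationMap_smul hx₀F hx₀ hτ (smul_mem_Ioo f hx) (hN.conj_mem g hg f),
        h g hg]
      field_simp) hx
  refine ⟨l, hl, translationMap N x₀ τ (f • x₀), fun x hx => ?_⟩
  have h2 := this x hx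
  field_simp at h2
  linarith

end Translation

/-! ### Excluding discrete translation numbers; averaging over cosets -/

section Translation

variable {G X : Type*} [Group G] [MulAction G X]
variable [CompleteLinearOrder X] {N : Subgroup G} {F : Set X} {x₀ : X} {τ : G → ℝ}

theorem IsTranslation.dense_or_cyclic (hτ : IsTranslation N x₀ τ) {a : G} (ha : a ∈ N)
    (hτa : 0 < τ a) :
    Dense (τ '' N) ∨ ∃ e ∈ N, 0 < τ e ∧ ∀ g ∈ N, ∃ z : ℤ, τ g = z * τ e := by
  let S : AddSubgroup ℝ :=
    { carrier := τ '' N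
      add_mem' := by
        rintro _ _ ⟨g, hg, rfl⟩ ⟨h, hh, rfl⟩
        exact ⟨g * h, N.mul_mem hg hh, hτ.map_mul g hg h hh⟩
      zero_mem' := ⟨1, N.one_mem, map_one_of_map_mul hτ.map_mul⟩
      neg_mem' := by
        rintro _ ⟨g, hg, rfl⟩
        exact ⟨g⁻¹, N.inv_mem hg, map_inv_of_map_mul hτ.map_mul hg⟩ }
  rcases AddSubgroup.dense_or_cyclic S with h | ⟨b, hb⟩
  · exact Or.inl h
  right
  have hmem : ∀ g ∈ N, ∃ z : ℤ, τ g = z * b := by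
    intro g hg
    have : τ g ∈ AddSubgroup.closure {b} := by rw [← hb]; exact ⟨g, hg, rfl⟩
    obtain ⟨z, hz⟩ := AddSubgroup.mem_closure_singleton.1 this
    exact ⟨z, by rw [← hz, zsmul_eq_mul]⟩
  have hbS : b ∈ S := by rw [hb]; exact AddSubgroup.mem_closure_singleton_self b
  obtain ⟨e, he, heb⟩ := hbS
  have hb0 : b ≠ 0 := by
    rintro rfl
    obtain ⟨z, hz⟩ := hmem a ha
    simp [hz] at hτa
  rcases lt_or_gt_of_ne hb0 with h | h
  · refine ⟨e⁻¹, N.inv_mem he, ?_, fun g hg => ?_⟩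
    · rw [map_inv_of_map_mul hτ.map_mul he, heb]; linarith
    · obtain ⟨z, hz⟩ := hmem g hg
      refine ⟨-z, ?_⟩
      rw [map_inv_of_map_mul hτ.map_mul he, heb, hz]; push_cast; ring
  · exact ⟨e, he, heb ▸ h, fun g hg => heb ▸ hmem g hg⟩

variable [CovariantClass G X (· • ·) (· ≤ ·)]

open scoped commutatorElement in
/-- The translation numbers of a commutator subgroup do not form a discrete group. -/
theorem IsAbelianOn.not_cyclic_of_commutator (hNF : IsAbelianOn N F) (hx₀F : x₀ ∈ F)
    (hx₀ : x₀ ∈ Ioo (⊥ : X) ⊤) (hτ : IsTranslation N x₀ τ)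
    (hfix : ∀ g ∈ N, (∃ x ∈ F, x ∈ Ioo (⊥ : X) ⊤ ∧ g • x = x) → g • x₀ = x₀)
    {e : G} (he : e ∈ N) (hτe : 0 < τ e) (hcyc : ∀ g ∈ N, ∃ z : ℤ, τ g = z * τ e)
    {M : Subgroup G} (hM : N = ⁅M, M⁆) : False := by
  have hN := hNF.normal
  -- A multiplier preserving the group of multiples of τ(e) is a positive integer; applied to f and
  -- f⁻¹, this forces it to be 1.
  have hge : ∀ f : G, ∃ l : ℝ, 1 ≤ l ∧ ∀ g ∈ N, τ (f * g * f⁻¹) = l * τ g := by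
    intro f
    obtain ⟨l, hl, h⟩ := hNF.exists_translation_conj hx₀F hx₀ hτ hfix he hτe f
    refine ⟨l, ?_, h⟩
    obtain ⟨z, hz⟩ := hcyc _ (hN.conj_mem e he f)
    rw [h e he] at hz
    have hlz : l = z := mul_right_cancel₀ hτe.ne' hz
    rw [hlz] at hl ⊢
    exact_mod_cast hl
  have hconj : ∀ f : G, ∀ g ∈ N, τ (f * g * f⁻¹) = τ g := by
    intro f g hg
    obtain ⟨l, hl, h⟩ := hge f
    obtain ⟨l', hl', h'⟩ := hge f⁻¹
    have h1 := h' _ (hN.conj_mem e he f)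
    rw [h e he, show f⁻¹ * (f * e * f⁻¹) * f⁻¹⁻¹ = e by group] at h1
    have h2 : l' * l = 1 := mul_right_cancel₀ hτe.ne' (by linarith)
    have h3 : l = 1 := by nlinarith
    rw [h g hg, h3, one_mul]
  -- Since τ is invariant under conjugation, elements with equal τ agree on the whole G-orbit of x₀,
  -- so N acts there centrally, by powers of `e`.
  have heq : ∀ g ∈ N, ∀ h ∈ N, τ g = τ h → ∀ f : G, g • f • x₀ = h • f • x₀ := by
    intro g hg h hh hgh f
    have h1 : (f⁻¹ * g * f⁻¹⁻¹) • x₀ = (f⁻¹ * h * f⁻¹⁻¹) • x₀ := by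
      have hgh' : τ (f⁻¹ * g * f⁻¹⁻¹) = τ (f⁻¹ * h * f⁻¹⁻¹) := by
        rw [hconj _ g hg, hconj _ h hh, hgh]
      exact le_antisymm
        ((hτ.le_iff (hN.conj_mem g hg _) (hN.conj_mem h hh _)).1 hgh'.le)
        ((hτ.le_iff (hN.conj_mem h hh _) (hN.conj_mem g hg _)).1 hgh'.ge)
    simpa [mul_smul] using h1
  have hcomm : ∀ f : G, ∀ u ∈ N, ∀ k : G, f • u • k • x₀ = u • f • k • x₀ := by
    intro f u hu k
    have := heq _ (hN.conj_mem u hu f) u hu (hconj f u hu) (f * k)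
    simpa [mul_smul] using this
  have hlt : x₀ < e • x₀ := (hτ.pos_iff e he).1 hτe
  have hfree : ∀ y ∈ F, y ∈ Ioo (⊥ : X) ⊤ → e • y ≠ y := fun y hyF hy hgy =>
    hlt.ne' (hfix e he ⟨y, hyF, hy, hgy⟩)
  have hmono := strictMono_zpow_smul hlt
  have key : ∀ f g : G, f ∈ M → g ∈ M → ⁅f, g⁆ • x₀ ≤ x₀ := by
    intro f g hf hg
    by_contra! hgt
    have hmem : ⁅f, g⁆ ∈ N := by rw [hM]; exact Subgroup.commutator_mem_commutator hf hg
    obtain ⟨z, hz⟩ := hcyc _ hmem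
    have hz1 : 1 ≤ z := by
      have := (hτ.pos_iff _ hmem).2 hgt
      rw [hz] at this
      have := pos_of_mul_pos_left this hτe.le
      exact_mod_cast this
    have hfg : ∀ k : G, f • g • k • x₀ = e ^ z • g • f • k • x₀ := by
      intro k
      have := heq _ hmem (e ^ z) (N.zpow_mem he z)
        (by rw [hz, map_zpow_of_map_mul hτ.map_mul he]) (g * f * k)
      rw [← mul_smul, ← mul_smul, mul_smul] at this
      simpa [mul_smul, commutatorElement_def] using this
    have hpow : ∀ n : ℕ, ∀ k : G, f ^ n • g • k • x₀ = e ^ (z * n) • g • f ^ n • k • x₀ := by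
      intro n
      induction n with
      | zero => intro k; simp
      | succ n ih =>
        intro k
        calc f ^ (n + 1) • g • k • x₀ = f ^ n • f • g • k • x₀ := by rw [pow_succ, mul_smul]
          _ = f ^ n • e ^ z • (g * f * k) • x₀ := by rw [hfg]; simp [mul_smul]
          _ = e ^ z • f ^ n • g • (f * k) • x₀ := by
            rw [hcomm _ _ (N.zpow_mem he z)]; simp [mul_smul]
          _ = e ^ (z * (n + 1 : ℕ)) • g • f ^ (n + 1) • k • x₀ := by
            rw [ih, pow_succ]; push_cast
            rw [mul_add, mul_one, add_comm (z * (n : ℤ)), zpow_add]; simp [mul_smul]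
    -- Measured in steps of `e`, g and f³ move x₀ by s and j up to an error of 1 each, so either
    -- order of composition gives s + j up to 2. But f³g = e^(3z) g f³ on the orbit, with 3z ≥ 3.
    obtain ⟨s, hs1, hs2⟩ := hNF.exists_zpow_smul_le_lt hfree hx₀F hx₀ hlt (smul_mem_Ioo g hx₀)
    obtain ⟨j, hj1, hj2⟩ :=
      hNF.exists_zpow_smul_le_lt hfree hx₀F hx₀ hlt (smul_mem_Ioo (f ^ 3) hx₀)
    have h3 := hpow 3 1
    rw [one_smul] at h3
    have hc1 := hcomm (f ^ 3) (e ^ (s + 1)) (N.zpow_mem he _) 1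
    have hc2 := hcomm g (e ^ j) (N.zpow_mem he _) 1
    rw [one_smul] at hc1 hc2
    have hup : f ^ 3 • g • x₀ ≤ e ^ (s + 1 + (j + 1)) • x₀ := by
      calc f ^ 3 • g • x₀ ≤ f ^ 3 • e ^ (s + 1) • x₀ := smul_mono_right _ hs2.le
        _ = e ^ (s + 1) • f ^ 3 • x₀ := hc1
        _ ≤ e ^ (s + 1) • e ^ (j + 1) • x₀ := smul_mono_right _ hj2.le
        _ = _ := by rw [zpow_add e (s + 1), mul_smul]
    have hdown : e ^ (z * (3 : ℕ) + (j + s)) • x₀ ≤ f ^ 3 • g • x₀ := by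
      rw [h3]
      calc e ^ (z * (3 : ℕ) + (j + s)) • x₀ = e ^ (z * (3 : ℕ)) • e ^ j • e ^ s • x₀ := by
            rw [zpow_add, zpow_add, mul_smul, mul_smul]
        _ ≤ e ^ (z * (3 : ℕ)) • e ^ j • g • x₀ :=
          smul_mono_right _ (smul_mono_right _ hs1)
        _ = e ^ (z * (3 : ℕ)) • g • e ^ j • x₀ := by rw [hc2]
        _ ≤ _ := smul_mono_right _ (smul_mono_right _ hj1)
    have := hmono.le_iff_le.1 (hdown.trans hup)
    push_cast at this
    omega
  obtain ⟨g, hg, hgx⟩ := hNF.exists_ne x₀ hx₀F hx₀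
  apply hgx
  have hle : ⁅M, M⁆ ≤ MulAction.stabilizer G x₀ := by
    rw [Subgroup.commutator_le]
    intro f hf g hg
    refine le_antisymm (key f g hf hg) ?_
    have := key g f hg hf
    rwa [← commutatorElement_inv, ← smul_le_smul_iff_of_action ⁅f, g⁆, smul_inv_smul] at this
  exact hle (hM ▸ hg)

/-- If `N` has finite index, averaging over its cosets gives an action by translations. -/
theorem IsAbelianOn.exists_translation_of_finiteIndex (hNF : IsAbelianOn N F) (hx₀F : x₀ ∈ F)
    (hx₀ : x₀ ∈ Ioo (⊥ : X) ⊤) (hτ : IsTranslation N x₀ τ)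
    (hfix : ∀ g ∈ N, (∃ x ∈ F, x ∈ Ioo (⊥ : X) ⊤ ∧ g • x = x) → g • x₀ = x₀)
    {a : G} (ha : a ∈ N) (hτa : 0 < τ a) (hfin : N.FiniteIndex) :
    ∃ h : X → ℝ, MonotoneOn h (Ioo ⊥ ⊤) ∧
      (∀ f : G, ∃ c : ℝ, ∀ x ∈ Ioo (⊥ : X) ⊤, h (f • x) = h x + c) ∧
      ∃ c : ℝ, c ≠ 0 ∧ ∀ x ∈ Ioo (⊥ : X) ⊤, h (a • x) = h x + c := by
  have hN := hNF.normal
  let := Fintype.ofFinite (G ⧸ N)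
  set k := translationMap N x₀ τ
  have hk := fun {x : X} (hx : x ∈ Ioo (⊥ : X) ⊤) {g : G} (hg : g ∈ N) =>
    hNF.translationMap_smul hx₀F hx₀ hτ hx hg
  refine ⟨fun x => ∑ q : G ⧸ N, k (q.out⁻¹ • x), ?_, ?_, ?_⟩
  · intro x hx y hy hxy
    exact Finset.sum_le_sum fun q _ => hNF.monotoneOn_translationMap hx₀F hx₀ hτ
      (smul_mem_Ioo _ hx) (smul_mem_Ioo _ hy) (smul_mono_right _ hxy)
  · intro f
    -- `f` permutes the cosets, and the change of representative lies in N, where k is equivariant.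
    have hmem : ∀ q : G ⧸ N, q.out⁻¹ * f * (f⁻¹ • q).out ∈ N := by
      intro q
      have : (QuotientGroup.mk (f⁻¹ • q).out : G ⧸ N) = QuotientGroup.mk (f⁻¹ * q.out) := by
        rw [QuotientGroup.out_eq', ← smul_eq_mul, ← MulAction.Quotient.smul_mk,
          QuotientGroup.out_eq']
      rw [eq_comm, QuotientGroup.eq] at this
      convert this using 1
      group
    refine ⟨∑ q : G ⧸ N, τ (q.out⁻¹ * f * (f⁻¹ • q).out), fun x hx => ?_⟩
    have hsum : ∑ q : G ⧸ N, k (q.out⁻¹ • x) = ∑ q : G ⧸ N, k ((f⁻¹ • q).out⁻¹ • x) :=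
      (Equiv.sum_comp (MulAction.toPerm f⁻¹ : Equiv.Perm (G ⧸ N))
        (fun q => k (q.out⁻¹ • x))).symm
    change ∑ q : G ⧸ N, k (q.out⁻¹ • f • x) = ∑ q : G ⧸ N, k (q.out⁻¹ • x) + _
    rw [hsum, ← Finset.sum_add_distrib]
    refine Finset.sum_congr rfl fun q _ => ?_
    rw [← hk (smul_mem_Ioo _ hx) (hmem q)]
    congr 1
    simp [mul_smul]
  · refine ⟨∑ q : G ⧸ N, τ (q.out⁻¹ * a * q.out⁻¹⁻¹), ?_, fun x hx => ?_⟩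
    · refine (Finset.sum_pos (fun q _ => ?_) Finset.univ_nonempty).ne'
      obtain ⟨l, hl, h⟩ := hNF.exists_translation_conj hx₀F hx₀ hτ hfix ha hτa q.out⁻¹
      rw [h a ha]
      exact mul_pos hl hτa
    · change ∑ q : G ⧸ N, k (q.out⁻¹ • a • x) = ∑ q : G ⧸ N, k (q.out⁻¹ • x) + _
      rw [← Finset.sum_add_distrib]
      refine Finset.sum_congr rfl fun q _ => ?_
      rw [← hk (smul_mem_Ioo _ hx) (hN.conj_mem a ha q.out⁻¹)]
      congr 1
      simp [mul_smul]

/-- The affine structure when some element of `N` acts on `F` without fixed points. -/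
theorem IsAbelianOn.exists_affine (hNF : IsAbelianOn N F) {a : G} (haN : a ∈ N)
    (ha : ∀ x ∈ F, x ∈ Ioo (⊥ : X) ⊤ → a • x ≠ x)
    (hN : N.FiniteIndex ∨ ∃ M : Subgroup G, N = ⁅M, M⁆) :
    ∃ h : X → ℝ, MonotoneOn h (Ioo ⊥ ⊤) ∧
      (∀ f : G, ∃ l : ℝ, 0 < l ∧ ∃ c : ℝ, ∀ x ∈ Ioo (⊥ : X) ⊤, h (f • x) = l * h x + c) ∧
      ∃ b : G, ∃ c : ℝ, c ≠ 0 ∧ ∀ x ∈ Ioo (⊥ : X) ⊤, h (b • x) = h x + c := by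
  obtain ⟨x₀, hx₀F, hx₀, hfix⟩ := hNF.exists_fixed_of_fixed haN ha
  obtain ⟨τ, hτ⟩ := hNF.exists_isTranslation hx₀F hx₀ hfix
  obtain ⟨a, haN, hτa⟩ : ∃ a ∈ N, 0 < τ a := by
    rcases lt_or_gt_of_ne (ha x₀ hx₀F hx₀) with h | h
    · refine ⟨a⁻¹, N.inv_mem haN, (hτ.pos_iff _ (N.inv_mem haN)).2 ?_⟩
      rwa [← smul_lt_smul_iff_of_action a, smul_inv_smul]
    · exact ⟨a, haN, (hτ.pos_iff _ haN).2 h⟩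
  rcases hN with hfin | ⟨M, hM⟩
  · obtain ⟨h, h1, h2, h3⟩ :=
      hNF.exists_translation_of_finiteIndex hx₀F hx₀ hτ hfix haN hτa hfin
    refine ⟨h, h1, fun f => ?_, a, h3⟩
    obtain ⟨c, hc⟩ := h2 f
    exact ⟨1, one_pos, c, fun x hx => by rw [hc x hx, one_mul]⟩
  · rcases hτ.dense_or_cyclic haN hτa with hd | ⟨e, he, hτe, hcyc⟩
    · exact ⟨translationMap N x₀ τ, hNF.monotoneOn_translationMap hx₀F hx₀ hτ,
        hNF.exists_affine_of_dense hx₀F hx₀ hτ hfix haN hτa hd, a, τ a, hτa.ne',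
        fun x hx => hNF.translationMap_smul hx₀F hx₀ hτ hx haN⟩
    · exact (hNF.not_cyclic_of_commutator hx₀F hx₀ hτ hfix he hτe hcyc hM).elim

end Translation

/-! ### Leaves and an expanded leaf -/

section Leaves

variable {G X : Type*} [Group G] [MulAction G X] [CompleteLinearOrder X]

/-- The interval `(u, v)` is a component of the complement of the fixed points of `a` in `F`. -/
structure IsLeaf (N : Subgroup G) (F : Set X) (a : G) (u v : X) : Prop where
  mem : a ∈ N
  left_mem : u ∈ F
  right_mem : v ∈ F
  bot_lt : ⊥ < u
  lt_top : v < ⊤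
  lt : u < v
  smul_left : a • u = u
  smul_right : a • v = v
  smul_ne : ∀ y ∈ F, u < y → y < v → a • y ≠ y

variable {N : Subgroup G} {F : Set X} {a b : G} {u v u' v' : X}

theorem IsLeaf.inv (h : IsLeaf N F a u v) : IsLeaf N F a⁻¹ u v where
  mem := N.inv_mem h.mem
  left_mem := h.left_mem
  right_mem := h.right_mem
  bot_lt := h.bot_lt
  lt_top := h.lt_top
  lt := h.lt
  smul_left := by rw [inv_smul_eq_iff, h.smul_left]
  smul_right := by rw [inv_smul_eq_iff, h.smul_right]
  smul_ne := by
    intro y hyF h1 h2 heq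
    rw [inv_smul_eq_iff] at heq
    exact h.smul_ne y hyF h1 h2 heq.symm

variable [CovariantClass G X (· • ·) (· ≤ ·)]

theorem IsLeaf.smul (hNF : IsAbelianOn N F) (h : IsLeaf N F a u v) (g : G) :
    IsLeaf N F (g * a * g⁻¹) (g • u) (g • v) where
  mem := hNF.normal.conj_mem a h.mem g
  left_mem := hNF.smul_mem g u h.left_mem
  right_mem := hNF.smul_mem g v h.right_mem
  bot_lt := (smul_mem_Ioo g ⟨h.bot_lt, h.lt.trans h.lt_top⟩).1
  lt_top := (smul_mem_Ioo g ⟨h.bot_lt.trans h.lt, h.lt_top⟩).2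
  lt := (smul_lt_smul_iff_of_action g).2 h.lt
  smul_left := by simp [mul_smul, h.smul_left]
  smul_right := by simp [mul_smul, h.smul_right]
  smul_ne := by
    intro y hyF h1 h2 heq
    refine h.smul_ne (g⁻¹ • y) (hNF.smul_mem _ y hyF) ?_ ?_ ?_
    · rwa [← smul_lt_smul_iff_of_action g, smul_inv_smul]
    · rwa [← smul_lt_smul_iff_of_action g, smul_inv_smul]
    · rw [mul_smul, mul_smul] at heq
      exact eq_inv_smul_iff.2 heq

theorem IsLeaf.smul_of_mem (hNF : IsAbelianOn N F) (h : IsLeaf N F a u v) (hb : b ∈ N) :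
    IsLeaf N F a (b • u) (b • v) where
  mem := h.mem
  left_mem := hNF.smul_mem b u h.left_mem
  right_mem := hNF.smul_mem b v h.right_mem
  bot_lt := (smul_mem_Ioo b ⟨h.bot_lt, h.lt.trans h.lt_top⟩).1
  lt_top := (smul_mem_Ioo b ⟨h.bot_lt.trans h.lt, h.lt_top⟩).2
  lt := (smul_lt_smul_iff_of_action b).2 h.lt
  smul_left := by rw [hNF.comm a h.mem b hb u h.left_mem, h.smul_left]
  smul_right := by rw [hNF.comm a h.mem b hb v h.right_mem, h.smul_right]
  smul_ne := by
    intro y hyF h1 h2 heq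
    refine h.smul_ne (b⁻¹ • y) (hNF.smul_mem _ y hyF) ?_ ?_ ?_
    · rwa [← smul_lt_smul_iff_of_action b, smul_inv_smul]
    · rwa [← smul_lt_smul_iff_of_action b, smul_inv_smul]
    · rw [hNF.comm a h.mem b⁻¹ (N.inv_mem hb) y hyF, heq]

/-- If v ≤ v', then `a` or a⁻¹ moves u' strictly inside (u', v'); the image is still fixed by `b`,
because a and b commute on F. -/
theorem IsLeaf.right_lt (hNF : IsAbelianOn N F) (h : IsLeaf N F a u v) (h' : IsLeaf N F b u' v')
    (h1 : u < u') (h2 : u' < v) : v' < v := by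
  by_contra! hle
  wlog hlt : u' < a • u' generalizing a
  · refine this h.inv ?_
    rw [← smul_lt_smul_iff_of_action a, smul_inv_smul]
    exact lt_of_le_of_ne (not_lt.1 hlt) (h.smul_ne u' h'.left_mem h1 h2)
  refine h'.smul_ne (a • u') (hNF.smul_mem a u' h'.left_mem) hlt ?_ ?_
  · refine lt_of_lt_of_le ?_ hle
    rw [← h.smul_right]
    exact (smul_lt_smul_iff_of_action a).2 h2
  · rw [hNF.comm b h'.mem a h.mem u' h'.left_mem, h'.smul_left]

theorem IsLeaf.lt_left (hNF : IsAbelianOn N F) (h : IsLeaf N F a u v) (h' : IsLeaf N F b u' v')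
    (h1 : u < v') (h2 : v' < v) : u < u' := by
  by_contra! hle
  wlog hlt : a • v' < v' generalizing a
  · refine this h.inv ?_
    rw [← smul_lt_smul_iff_of_action a, smul_inv_smul]
    exact lt_of_le_of_ne (not_lt.1 hlt) (h.smul_ne v' h'.right_mem h1 h2).symm
  refine h'.smul_ne (a • v') (hNF.smul_mem a v' h'.right_mem) ?_ hlt ?_
  · refine lt_of_le_of_lt hle ?_
    rw [← h.smul_left]
    exact (smul_lt_smul_iff_of_action a).2 h1
  · rw [hNF.comm b h'.mem a h.mem v' h'.right_mem, h'.smul_right]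

theorem IsLeaf.trichotomy (hNF : IsAbelianOn N F) (h : IsLeaf N F a u v)
    (h' : IsLeaf N F b u' v') (h1 : u < v') (h2 : u' < v) :
    (u = u' ∧ v = v') ∨ (u < u' ∧ v' < v) ∨ (u' < u ∧ v < v') := by
  rcases lt_trichotomy u u' with hu | hu | hu
  · exact Or.inr (Or.inl ⟨hu, h.right_lt hNF h' hu h2⟩)
  · rcases lt_trichotomy v v' with hv | hv | hv
    · exact absurd (h'.lt_left hNF h h2 hv) hu.not_gt
    · exact Or.inl ⟨hu, hv⟩
    · exact absurd (h.lt_left hNF h' h1 hv) hu.not_lt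
  · exact Or.inr (Or.inr ⟨hu, h'.right_lt hNF h hu h1⟩)

theorem IsLeaf.eq_of_same (hNF : IsAbelianOn N F) (h : IsLeaf N F a u v)
    (h' : IsLeaf N F a u' v') (h1 : u < v') (h2 : u' < v) : u = u' ∧ v = v' := by
  rcases h.trichotomy hNF h' h1 h2 with hh | hh | hh
  · exact hh
  · exact absurd h'.smul_left (h.smul_ne u' h'.left_mem hh.1 h2)
  · exact absurd h.smul_left (h'.smul_ne u h.left_mem hh.1 h1)

/-- Take g in N with g y > z. N-translates of a g-fixed point are g-fixed and lie on both sides of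
y, so y is in a bounded gap of the fixed set of g; the gap also contains z, as g v = v. -/
theorem IsAbelianOn.exists_isLeaf (hNF : IsAbelianOn N F)
    (hfix : ∀ a ∈ N, ∃ q ∈ F, q ∈ Ioo (⊥ : X) ⊤ ∧ a • q = q) {y z : X} (hyF : y ∈ F)
    (hy : ⊥ < y) (hyz : y ≤ z) (hz : z < ⊤) : ∃ a u v, IsLeaf N F a u v ∧ u < y ∧ z < v := by
  obtain ⟨g, hg, hgy⟩ := exists_lt_smul N hNF.sSup_mem (fun g _ => hNF.smul_mem g) hNF.exists_ne
    hyF hy hz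
  obtain ⟨q, hqF, hq, hgq⟩ := hfix g hg
  obtain ⟨f, hf, hfy⟩ := exists_smul_lt N hNF.sInf_mem (fun g _ => hNF.smul_mem g) hNF.exists_ne
    hqF hq.2 hy
  obtain ⟨k, hk, hky⟩ := exists_lt_smul N hNF.sSup_mem (fun g _ => hNF.smul_mem g) hNF.exists_ne
    hqF hq.1 (hyz.trans_lt hz)
  have hgf : g • f • q = f • q := by rw [hNF.comm g hg f hf q hqF, hgq]
  have hgk : g • k • q = k • q := by rw [hNF.comm g hg k hk q hqF, hgq]
  set A : Set X := {x | x ∈ F ∧ g • x = x ∧ x ≤ y}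
  set B : Set X := {x | x ∈ F ∧ g • x = x ∧ y ≤ x}
  have hgu : g • sSup A = sSup A := by
    rw [smul_sSup_of_action, show (g • ·) '' A = id '' A from image_congr fun x hx => hx.2.1,
      image_id]
  have hgv : g • sInf B = sInf B := by
    rw [smul_sInf_of_action, show (g • ·) '' B = id '' B from image_congr fun x hx => hx.2.1,
      image_id]
  have huy : sSup A < y := by
    refine lt_of_le_of_ne (sSup_le fun x hx => hx.2.2) fun h => ?_
    rw [h] at hgu
    exact (hyz.trans_lt hgy).ne' hgu
  have hyv : y < sInf B := by
    refine lt_of_le_of_ne (le_sInf fun x hx => hx.2.2) fun h => ?_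
    rw [← h] at hgv
    exact (hyz.trans_lt hgy).ne' hgv
  refine ⟨g, sSup A, sInf B, ⟨hg, hNF.sSup_mem _ fun x hx => hx.1, hNF.sInf_mem _ fun x hx => hx.1,
    ?_, ?_, huy.trans hyv, hgu, hgv, ?_⟩, huy, ?_⟩
  · exact (smul_mem_Ioo f hq).1.trans_le (le_sSup ⟨hNF.smul_mem f q hqF, hgf, hfy.le⟩)
  · exact lt_of_le_of_lt (sInf_le ⟨hNF.smul_mem k q hqF, hgk, hky.le⟩) (smul_mem_Ioo k hq).2
  · intro x hxF h1 h2 hgx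
    rcases le_total x y with h | h
    · exact h1.not_ge (le_sSup ⟨hxF, hgx, h⟩)
    · exact h2.not_ge (sInf_le ⟨hxF, hgx, h⟩)
  · rw [← hgv]
    exact hgy.trans ((smul_lt_smul_iff_of_action g).2 hyv)

/-- If `G` is finitely generated and all elements of `N` have fixed points in `F`, then some leaf
is mapped strictly over itself. -/
theorem IsAbelianOn.exists_isLeaf_expanded [Group.FG G] (hNF : IsAbelianOn N F)
    (hfix : ∀ a ∈ N, ∃ q ∈ F, q ∈ Ioo (⊥ : X) ⊤ ∧ a • q = q) :
    ∃ (a : G) (u v : X) (t : G), IsLeaf N F a u v ∧ t • u < u ∧ v < t • v := by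
  classical
  obtain ⟨S, hS⟩ := Group.fg_def.1 ‹Group.FG G›
  obtain ⟨p, hpF, hp⟩ := hNF.nonempty
  have hne : (insert 1 S).Nonempty := ⟨1, Finset.mem_insert_self _ _⟩
  obtain ⟨s₀, hs₀, hmin⟩ := (insert 1 S).exists_min_image (fun s => s • p) hne
  obtain ⟨s₁, -, hmax⟩ := (insert 1 S).exists_max_image (fun s => s • p) hne
  -- The leaf contains p and all its images under generators, so every generator maps it to an
  -- overlapping leaf: the same one, or one nested with it.
  obtain ⟨a, u, v, hleaf, hu, hv⟩ := hNF.exists_isLeaf hfix (hNF.smul_mem s₀ p hpF)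
    (smul_mem_Ioo s₀ hp).1 (hmax s₀ hs₀) (smul_mem_Ioo s₁ hp).2
  have hbetween : ∀ s ∈ insert 1 S, u < s • p ∧ s • p < v := fun s hs =>
    ⟨hu.trans_le (hmin s hs), (hmax s hs).trans_lt hv⟩
  have hpuv := hbetween 1 (Finset.mem_insert_self _ _)
  rw [one_smul] at hpuv
  obtain ⟨s, hsS, hsu⟩ : ∃ s ∈ S, s • u ≠ u := by
    by_contra! hcon
    obtain ⟨f, -, hf⟩ := hNF.exists_ne u hleaf.left_mem ⟨hleaf.bot_lt, hleaf.lt.trans hleaf.lt_top⟩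
    have hle : Subgroup.closure (S : Set G) ≤ MulAction.stabilizer G u :=
      (Subgroup.closure_le _).2 hcon
    exact hf (hle (hS ▸ Subgroup.mem_top f))
  have hs := hbetween s (Finset.mem_insert_of_mem hsS)
  rcases hleaf.trichotomy hNF (hleaf.smul hNF s)
    (hs.1.trans ((smul_lt_smul_iff_of_action s).2 hpuv.2))
    (((smul_lt_smul_iff_of_action s).2 hpuv.1).trans hs.2) with h | h | h
  · exact (hsu h.1.symm).elim
  · refine ⟨a, u, v, s⁻¹, hleaf, ?_, ?_⟩
    · rw [← smul_lt_smul_iff_of_action s, smul_inv_smul]; exact h.1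
    · rw [← smul_lt_smul_iff_of_action s, smul_inv_smul]; exact h.2
  · exact ⟨a, u, v, s, hleaf, h.1, h.2⟩

theorem strictAnti_pow_smul {t : G} {u : X} (h : t • u < u) : StrictAnti fun n : ℕ => t ^ n • u :=
  strictAnti_nat_of_succ_lt fun n => by
    rw [pow_succ, mul_smul]; exact (smul_lt_smul_iff_of_action _).2 h

theorem strictMono_pow_smul {t : G} {v : X} (h : v < t • v) : StrictMono fun n : ℕ => t ^ n • v :=
  strictMono_nat_of_lt_succ fun n => by
    rw [pow_succ, mul_smul]; exact (smul_lt_smul_iff_of_action _).2 h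

theorem smul_sInf_pow_smul {t : G} {u : X} (h : t • u < u) :
    t • sInf (range fun n : ℕ => t ^ n • u) = sInf (range fun n : ℕ => t ^ n • u) := by
  rw [smul_sInf_of_action]
  refine le_antisymm (le_sInf ?_) (le_sInf ?_)
  · rintro _ ⟨n, rfl⟩
    refine (sInf_le (mem_image_of_mem _ (mem_range_self n))).trans ?_
    change t • t ^ n • u ≤ t ^ n • u
    rw [← mul_smul, ← pow_succ']
    exact (strictAnti_pow_smul h).antitone n.le_succ
  · rintro _ ⟨_, ⟨n, rfl⟩, rfl⟩
    refine (sInf_le (mem_range_self (n + 1))).trans (le_of_eq ?_)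
    change t ^ (n + 1) • u = t • t ^ n • u
    rw [← mul_smul, ← pow_succ']

namespace IsLeaf

variable {t : G}

/-- `a` sends the leaf t^n(u, v) to a leaf of the same element. The two overlap because `a` fixes u
and v, so they coincide. -/
theorem smul_pow_smul (h : IsLeaf N F a u v) (hNF : IsAbelianOn N F) (hu : t • u < u)
    (hv : v < t • v) (n : ℕ) : a • t ^ n • u = t ^ n • u := by
  have hun : t ^ n • u ≤ u := by
    simpa using (strictAnti_pow_smul hu).antitone (Nat.zero_le n)
  have hvn : v ≤ t ^ n • v := by
    simpa using (strictMono_pow_smul hv).monotone (Nat.zero_le n)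
  have hn := h.smul hNF (t ^ n)
  refine ((hn.eq_of_same hNF (hn.smul_of_mem hNF h.mem) ?_ ?_).1).symm
  · refine (hun.trans_lt h.lt).trans_le ?_
    rw [← h.smul_right]
    simpa [h.smul_right] using smul_mono_right a hvn
  · refine lt_of_le_of_lt ?_ (h.lt.trans_le hvn)
    simpa [h.smul_left] using smul_mono_right a hun

/-- The conjugate of `a` whose leaf is t^(n+1)(u, v) fixes no point of F inside it. It therefore
moves the smaller leaf t^n(u, v), to a leaf of the same element, hence off itself. -/
theorem disjoint_pow (h : IsLeaf N F a u v) (hNF : IsAbelianOn N F) (hu : t • u < u)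
    (hv : v < t • v) (n : ℕ) :
    (t ^ (n + 1) * a * (t ^ (n + 1))⁻¹) • t ^ n • v ≤ t ^ n • u ∨
      t ^ n • v ≤ (t ^ (n + 1) * a * (t ^ (n + 1))⁻¹) • t ^ n • u := by
  by_contra! hcon
  have hI := h.smul hNF (t ^ n)
  have hI' := h.smul hNF (t ^ (n + 1))
  have heq := hI.eq_of_same hNF (hI.smul_of_mem hNF hI'.mem) hcon.1 hcon.2
  refine hI'.smul_ne _ hI.left_mem (strictAnti_pow_smul hu n.lt_succ_self) ?_ heq.1.symm
  exact hI.lt.trans_le ((strictMono_pow_smul hv).monotone n.le_succ)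

theorem smul_sInf_range_pow (h : IsLeaf N F a u v) (hNF : IsAbelianOn N F) (hu : t • u < u)
    (hv : v < t • v) :
    a • sInf (range fun n : ℕ => t ^ n • u) = sInf (range fun n : ℕ => t ^ n • u) := by
  rw [smul_sInf_of_action, ← range_comp]
  congr 2
  funext n
  exact h.smul_pow_smul hNF hu hv n

end IsLeaf

end Leaves

/-! ### Derivatives at a fixed point -/

section Slope

/-- The extension to `ℝ` of a self-map of `[0,1]`, constant outside `[0,1]`. -/
noncomputable def extendIcc (f : Icc (0 : ℝ) 1 → Icc (0 : ℝ) 1) : ℝ → ℝ :=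
  fun x => f (projIcc 0 1 zero_le_one x)

theorem extendIcc_coe (f : Icc (0 : ℝ) 1 → Icc (0 : ℝ) 1) (x : Icc (0 : ℝ) 1) :
    extendIcc f x = f x := by
  rw [extendIcc, projIcc_val]

theorem extendIcc_of_mem (f : Icc (0 : ℝ) 1 → Icc (0 : ℝ) 1) {x : ℝ} (hx : x ∈ Icc (0 : ℝ) 1) :
    extendIcc f x = f ⟨x, hx⟩ :=
  extendIcc_coe f ⟨x, hx⟩

theorem IsC1.contDiffOn_extendIcc {f : Icc (0 : ℝ) 1 → Icc (0 : ℝ) 1} (hf : IsC1 f) :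
    ContDiffOn ℝ 1 (extendIcc f) (Icc 0 1) := by
  obtain ⟨F, hF, h⟩ := hf
  refine hF.congr fun x hx => ?_
  rw [extendIcc_of_mem f hx, ← h]

/-- The derivative at a point of a self-map of `[0,1]`. -/
noncomputable def slopeAt (α : Icc (0 : ℝ) 1) (f : Icc (0 : ℝ) 1 → Icc (0 : ℝ) 1) : ℝ :=
  derivWithin (extendIcc f) (Icc 0 1) α

theorem slopeAt_comp {f g : Icc (0 : ℝ) 1 → Icc (0 : ℝ) 1} (hf : IsC1 f) (hg : IsC1 g)
    {α : Icc (0 : ℝ) 1} (hα : g α = α) :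
    slopeAt α (fun x => f (g x)) = slopeAt α f * slopeAt α g := by
  have hgα : extendIcc g α = α := by rw [extendIcc_coe, hα]
  have hcomp : extendIcc (fun x => f (g x)) = extendIcc f ∘ extendIcc g := by
    funext x
    simp [extendIcc]
  have hF := (hf.contDiffOn_extendIcc.differentiableOn one_ne_zero) α α.2
  have hK := (hg.contDiffOn_extendIcc.differentiableOn one_ne_zero) α α.2
  rw [slopeAt, hcomp, derivWithin_comp _ (s' := Icc 0 1), hgα]
  · rfl
  · rwa [hgα]
  · exact hK
  · intro x _
    exact (g _).2

theorem slopeAt_id (α : Icc (0 : ℝ) 1) : slopeAt α (fun x => x) = 1 := by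
  have : ∀ x ∈ Icc (0 : ℝ) 1, extendIcc (fun x => x) x = id x := fun x hx => by
    rw [extendIcc_of_mem _ hx]; rfl
  rw [slopeAt, derivWithin_congr this (this α α.2), derivWithin_id _ _
    (uniqueDiffOn_Icc_zero_one α α.2)]

theorem slopeAt_nonneg {f : Icc (0 : ℝ) 1 → Icc (0 : ℝ) 1} (hf : Monotone f)
    (α : Icc (0 : ℝ) 1) : 0 ≤ slopeAt α f := by
  refine MonotoneOn.derivWithin_nonneg fun x _ y _ hxy => ?_
  exact hf (monotone_projIcc _ hxy)

theorem slopeAt_pos {f : Icc (0 : ℝ) 1 ≃ₜ Icc (0 : ℝ) 1} (hf : f ∈ Diff₀) {α : Icc (0 : ℝ) 1}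
    (hα : f α = α) : 0 < slopeAt α f := by
  refine lt_of_le_of_ne (slopeAt_nonneg hf.1.monotone α) fun h => ?_
  have h1 := slopeAt_comp hf.2.1 hf.2.2 (f.symm_apply_eq.2 hα.symm)
  simp [← h, slopeAt_id] at h1

theorem exists_slope_mul_le {f : Icc (0 : ℝ) 1 → Icc (0 : ℝ) 1} (hf : IsC1 f)
    {α : Icc (0 : ℝ) 1} (hpos : 0 < slopeAt α f) {η : ℝ} (hη : η < 1) :
    ∃ δ > 0, ∀ x y : Icc (0 : ℝ) 1, α ≤ x → x ≤ y → (y : ℝ) < α + δ →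
      η * slopeAt α f * (y - x) ≤ f y - f x := by
  have hC := hf.contDiffOn_extendIcc
  have hcont : ContinuousWithinAt (derivWithin (extendIcc f) (Icc 0 1)) (Icc 0 1) α :=
    hC.continuousOn_derivWithin uniqueDiffOn_Icc_zero_one le_rfl α α.2
  have hlt : η * slopeAt α f < derivWithin (extendIcc f) (Icc 0 1) α :=
    mul_lt_of_lt_one_left hpos hη
  obtain ⟨δ, hδ, hsub⟩ := Metric.mem_nhdsWithin_iff.1 (hcont.eventually (lt_mem_nhds hlt))
  refine ⟨δ, hδ, fun x y hαx hxy hy => ?_⟩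
  have hss : Icc (x : ℝ) y ⊆ Icc 0 1 := Icc_subset_Icc x.2.1 y.2.2
  have := (convex_Icc (x : ℝ) y).mul_sub_le_image_sub_of_le_deriv (f := extendIcc f)
    (C := η * slopeAt α f) (hC.continuousOn.mono hss) ?_ ?_ x (left_mem_Icc.2 hxy) y
    (right_mem_Icc.2 hxy) hxy
  · rwa [extendIcc_coe, extendIcc_coe] at this
  · rw [interior_Icc]
    exact ((hC.differentiableOn one_ne_zero).mono (Ioo_subset_Icc_self.trans hss))
  · intro z hz
    rw [interior_Icc] at hz
    have hz' : z ∈ Icc (0 : ℝ) 1 := hss (Ioo_subset_Icc_self hz)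
    have hnhds : Icc (0 : ℝ) 1 ∈ nhds z :=
      Icc_mem_nhds (x.2.1.trans_lt hz.1) (hz.2.trans_le y.2.2)
    rw [← derivWithin_of_mem_nhds hnhds]
    refine le_of_lt (hsub ⟨?_, hz'⟩)
    have hαz : (α : ℝ) ≤ z := le_trans hαx hz.1.le
    rw [Metric.mem_ball, Real.dist_eq, abs_of_nonneg (sub_nonneg.2 hαz)]
    linarith [hz.2]

/-- The inverse is C¹ on a compact interval, hence Lipschitz. -/
theorem exists_mul_sub_le {f : Icc (0 : ℝ) 1 ≃ₜ Icc (0 : ℝ) 1} (hf : f ∈ Diff₀) :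
    ∃ c > 0, ∀ x y : Icc (0 : ℝ) 1, x ≤ y → c * ((y : ℝ) - x) ≤ f y - f x := by
  obtain ⟨K, hK⟩ := hf.2.2.contDiffOn_extendIcc.exists_lipschitzOnWith one_ne_zero
    (convex_Icc 0 1) isCompact_Icc
  refine ⟨((K : ℝ) + 1)⁻¹, by positivity, fun x y hxy => ?_⟩
  rw [inv_mul_le_iff₀ (by positivity)]
  have h := hK.dist_le_mul (f y) (f y).2 (f x) (f x).2
  rw [extendIcc_coe, extendIcc_coe, f.symm_apply_apply, f.symm_apply_apply, Real.dist_eq,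
    Real.dist_eq] at h
  have hle : (f x : ℝ) ≤ f y := hf.1.monotone hxy
  rw [abs_of_nonneg (sub_nonneg.2 hle)] at h
  have := le_abs_self ((y : ℝ) - x)
  nlinarith

/-- The metric properties of an action on `[0,1]` by `C¹` diffeomorphisms, where `D` is the
derivative at `α` of the elements fixing this point. -/
structure IsC1Action (G : Type*) [Group G] [MulAction G (Icc (0 : ℝ) 1)] (α : Icc (0 : ℝ) 1)
    (D : G → ℝ) : Prop where
  map_mul : ∀ g h : G, h • α = α → D (g * h) = D g * D h
  pos : ∀ g : G, g • α = α → 0 < D g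
  exists_slope_le : ∀ g : G, g • α = α → ∀ η < 1, ∃ δ > 0, ∀ x y : Icc (0 : ℝ) 1, α ≤ x → x ≤ y →
    (y : ℝ) < α + δ → η * D g * (y - x) ≤ (g • y : Icc (0 : ℝ) 1) - (g • x : Icc (0 : ℝ) 1)
  exists_mul_le : ∀ g : G, ∃ c > 0, ∀ x y : Icc (0 : ℝ) 1, x ≤ y →
    c * ((y : ℝ) - x) ≤ (g • y : Icc (0 : ℝ) 1) - (g • x : Icc (0 : ℝ) 1)

theorem isC1Action_of_hom {G : Type*} [Group G] [MulAction G (Icc (0 : ℝ) 1)] (φ : G →* Diff₀)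
    (hφ : ∀ g x, g • x = (φ g).1 x) (α : Icc (0 : ℝ) 1) :
    IsC1Action G α fun g => slopeAt α (φ g).1 where
  map_mul g h hα := by
    rw [map_mul]
    exact slopeAt_comp (φ g).2.2.1 (φ h).2.2.1 (by rw [← hφ, hα])
  pos g hα := slopeAt_pos (φ g).2 (by rw [← hφ, hα])
  exists_slope_le g hα η hη := by
    simp only [hφ]
    exact exists_slope_mul_le (φ g).2.2.1 (slopeAt_pos (φ g).2 (by rw [← hφ, hα])) hη
  exists_mul_le g := by
    simp only [hφ]
    exact exists_mul_sub_le (φ g).2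

namespace IsC1Action

variable {G : Type*} [Group G] [MulAction G (Icc (0 : ℝ) 1)] {α : Icc (0 : ℝ) 1} {D : G → ℝ}

theorem map_one (hD : IsC1Action G α D) : D 1 = 1 := by
  have h := hD.map_mul 1 1 (one_smul _ _)
  rw [mul_one] at h
  exact (mul_eq_left₀ (hD.pos 1 (one_smul _ _)).ne').1 h.symm

theorem map_inv (hD : IsC1Action G α D) {g : G} (hg : g • α = α) : D g⁻¹ = (D g)⁻¹ := by
  have h := hD.map_mul g⁻¹ g hg
  rw [inv_mul_cancel, hD.map_one] at h
  exact eq_inv_of_mul_eq_one_left h.symm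

theorem exists_slope_inv_le (hD : IsC1Action G α D) {g : G} (hg : g • α = α) {η : ℝ}
    (hη : η < 1) : ∃ δ > 0, ∀ x y : Icc (0 : ℝ) 1, α ≤ x → x ≤ y → (y : ℝ) < α + δ →
      η * (D g)⁻¹ * (y - x) ≤ (g⁻¹ • y : Icc (0 : ℝ) 1) - (g⁻¹ • x : Icc (0 : ℝ) 1) := by
  rw [← hD.map_inv hg]
  exact hD.exists_slope_le g⁻¹ (inv_smul_eq_iff.2 hg.symm) η hη

/-- An element with fixed points accumulating at `α` has derivative `1` there. -/
theorem eq_one_of_fixed (hD : IsC1Action G α D) {a : G} (haα : a • α = α)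
    (hfix : ∀ δ > 0, ∃ x : Icc (0 : ℝ) 1, α < x ∧ (x : ℝ) < α + δ ∧ a • x = x) : D a = 1 := by
  have key : ∀ b : G, b • α = α → (∀ δ > 0, ∃ x : Icc (0 : ℝ) 1, α < x ∧ (x : ℝ) < α + δ ∧
      b • x = x) → D b ≤ 1 := by
    intro b hb hbfix
    by_contra! hlt
    -- This η makes η · D b = (D b + 1)/2 > 1, which is impossible between α and a nearby fixed
    -- point.
    obtain ⟨δ, hδ, h⟩ := hD.exists_slope_le b hb ((1 + (D b)⁻¹) / 2) (by
      have := inv_lt_one_of_one_lt₀ hlt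
      linarith)
    obtain ⟨x, hx, hxδ, hbx⟩ := hbfix δ hδ
    have h1 := h α x le_rfl hx.le hxδ
    rw [hb, hbx] at h1
    have hx' : (0 : ℝ) < x - α := sub_pos.2 hx
    have h2 := le_of_mul_le_mul_right (h1.trans_eq (one_mul _).symm) hx'
    have h3 : (D b)⁻¹ * D b = 1 := inv_mul_cancel₀ (hD.pos b hb).ne'
    linarith
  refine le_antisymm (key a haα hfix) ?_
  have h := key a⁻¹ (inv_smul_eq_iff.2 haα.symm) (fun δ hδ => by
    obtain ⟨x, h1, h2, h3⟩ := hfix δ hδ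
    exact ⟨x, h1, h2, inv_smul_eq_iff.2 h3.symm⟩)
  rw [hD.map_inv haα] at h
  exact (inv_le_one₀ (hD.pos a haα)).1 h

end IsC1Action

end Slope

/-! ### Counting copies in a tower of intervals -/

section Counting

variable {G : Type*} [Group G]

/-- The product `c (n - 1) ^ w (n - 1) * ⋯ * c 0 ^ w 0`. -/
def wordProd (c : ℕ → G) (w : ℕ → ℕ) : ℕ → G
  | 0 => 1
  | n + 1 => c n ^ w n * wordProd c w n

theorem wordProd_congr (c : ℕ → G) {w w' : ℕ → ℕ} {n : ℕ} (h : ∀ k < n, w k = w' k) :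
    wordProd c w n = wordProd c w' n := by
  induction n with
  | zero => rfl
  | succ n ih =>
    rw [wordProd, wordProd, h n n.lt_succ_self, ih fun k hk => h k (hk.trans n.lt_succ_self)]

/-- `L b k` stands for the length of the image under b of the k-th interval of a tower. Each level
holds N copies of the previous one, so n levels hold N^n copies of the bottom interval. -/
theorem pow_mul_le_of_sum_le {L : G → ℕ → ℝ} {c : ℕ → G} {N m : ℕ} (hN : 0 < N)
    (hL : ∀ k < m, ∀ b : G, ∑ i ∈ Finset.range N, L (b * c k ^ i) k ≤ L b (k + 1)) (n : ℕ)
    (hn : n ≤ m) {κ : ℝ} (b : G) (hκ : ∀ w : ℕ → ℕ, (∀ k, w k < N) →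
      κ ≤ L (b * wordProd c w n) 0) : (N : ℝ) ^ n * κ ≤ L b n := by
  induction n generalizing b with
  | zero => simpa [wordProd] using hκ (fun _ => 0) fun _ => hN
  | succ n ih =>
    calc (N : ℝ) ^ (n + 1) * κ = ∑ i ∈ Finset.range N, (N : ℝ) ^ n * κ := by
          rw [Finset.sum_const, Finset.card_range, nsmul_eq_mul]; ring
      _ ≤ ∑ i ∈ Finset.range N, L (b * c n ^ i) n := by
          refine Finset.sum_le_sum fun i hi => ih (by omega) _ fun w hw => ?_
          have h := hκ (Function.update w n i) fun k => by
            rcases eq_or_ne k n with rfl | hk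
            · simpa using hi
            · simpa [hk] using hw k
          rwa [wordProd, Function.update_self, ← mul_assoc,
            wordProd_congr c (w' := w) fun k hk => Function.update_of_ne hk.ne _ _] at h
      _ ≤ L b (n + 1) := hL n (by omega) b

end Counting

/-! ### Lower bounds for lengths of images -/

section Expands

variable {G : Type*} [Group G] [MulAction G (Icc (0 : ℝ) 1)]

/-- The length of the image of the interval `[u, v]` under `g`. -/
def lengthOf (g : G) (u v : Icc (0 : ℝ) 1) : ℝ :=
  ((g • v : Icc (0 : ℝ) 1) : ℝ) - (g • u : Icc (0 : ℝ) 1)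

theorem lengthOf_one (u v : Icc (0 : ℝ) 1) : lengthOf (1 : G) u v = v - u := by simp [lengthOf]

theorem lengthOf_mul (g h : G) (u v : Icc (0 : ℝ) 1) :
    lengthOf (g * h) u v = lengthOf g (h • u) (h • v) := by simp [lengthOf, mul_smul]

theorem lengthOf_le_one (g : G) (u v : Icc (0 : ℝ) 1) : lengthOf g u v ≤ 1 := by
  have h1 := (g • v : Icc (0 : ℝ) 1).2.2
  have h2 := (g • u : Icc (0 : ℝ) 1).2.1
  rw [lengthOf]; linarith

/-- `g` fixes `α`, maps `[α, p]` into `[α, q]` and multiplies lengths there by at least `ρ`. -/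
def Expands (α : Icc (0 : ℝ) 1) (g : G) (p q : Icc (0 : ℝ) 1) (ρ : ℝ) : Prop :=
  g • α = α ∧ ∀ x y : Icc (0 : ℝ) 1, α ≤ x → x ≤ y → y ≤ p →
    g • y ≤ q ∧ ρ * ((y : ℝ) - x) ≤ lengthOf g x y

variable {α : Icc (0 : ℝ) 1}

theorem expands_one (p : Icc (0 : ℝ) 1) : Expands α (1 : G) p p 1 :=
  ⟨one_smul _ _, fun x y _ _ hy => ⟨by rwa [one_smul], by rw [lengthOf_one, one_mul]⟩⟩

theorem Expands.mono {g : G} {p q : Icc (0 : ℝ) 1} {ρ ρ' : ℝ} (h : Expands α g p q ρ)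
    (hρ : ρ' ≤ ρ) : Expands α g p q ρ' :=
  ⟨h.1, fun x y hx hxy hy => ⟨(h.2 x y hx hxy hy).1,
    (mul_le_mul_of_nonneg_right hρ (sub_nonneg.2 hxy)).trans (h.2 x y hx hxy hy).2⟩⟩

variable [CovariantClass G (Icc (0 : ℝ) 1) (· • ·) (· ≤ ·)]

theorem lengthOf_mono (g : G) {u v u' v' : Icc (0 : ℝ) 1} (hu : u' ≤ u) (hv : v ≤ v') :
    lengthOf g u v ≤ lengthOf g u' v' :=
  sub_le_sub (smul_mono_right g hv) (smul_mono_right g hu)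

theorem Expands.mul {g h : G} {p q r : Icc (0 : ℝ) 1} {ρ σ : ℝ} (hh : Expands α h q r σ)
    (hg : Expands α g p q ρ) (hσ : 0 ≤ σ) : Expands α (h * g) p r (σ * ρ) := by
  refine ⟨by rw [mul_smul, hg.1, hh.1], fun x y hx hxy hy => ?_⟩
  obtain ⟨h1, h2⟩ := hg.2 x y hx hxy hy
  obtain ⟨h3, h4⟩ := hh.2 (g • x) (g • y) (by rw [← hg.1]; exact smul_mono_right g hx)
    (smul_mono_right g hxy) h1
  rw [mul_smul, lengthOf_mul, mul_assoc]
  exact ⟨h3, (mul_le_mul_of_nonneg_left h2 hσ).trans h4⟩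

theorem Expands.pow {g : G} {p : Icc (0 : ℝ) 1} {ρ : ℝ} (hg : Expands α g p p ρ) (hρ : 0 ≤ ρ)
    (n : ℕ) : Expands α (g ^ n) p p (ρ ^ n) := by
  induction n with
  | zero => simpa using expands_one (G := G) p
  | succ n ih => rw [pow_succ, pow_succ]; exact ih.mul hg (pow_nonneg hρ n)

theorem pow_mul_le_lengthOf {t : G} {c₀ : ℝ} (hc₀ : 0 ≤ c₀)
    (hc : ∀ x y : Icc (0 : ℝ) 1, x ≤ y → c₀ * ((y : ℝ) - x) ≤ lengthOf t x y) (n : ℕ)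
    {x y : Icc (0 : ℝ) 1} (hxy : x ≤ y) : c₀ ^ n * ((y : ℝ) - x) ≤ lengthOf (t ^ n) x y := by
  induction n generalizing x y with
  | zero => simp [lengthOf]
  | succ n ih =>
    rw [pow_succ t, lengthOf_mul, pow_succ, mul_assoc]
    exact (mul_le_mul_of_nonneg_left (hc x y hxy) (pow_nonneg hc₀ n)).trans
      (ih (smul_mono_right t hxy))

theorem pow_smul_eq_of_smul_eq {G X : Type*} [Group G] [MulAction G X] {c : G} {x : X}
    (h : c • x = x) (n : ℕ) : c ^ n • x = x :=
  (MulAction.stabilizer G x).pow_mem h n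

/-- Successive images of [u, v] under powers of `c` follow each other in one direction and stay in
the c-invariant interval [u', v'], so the sum telescopes. -/
theorem sum_lengthOf_le {c : G} {u v u' v' : Icc (0 : ℝ) 1} (huv : u ≤ v)
    (hdisj : c • v ≤ u ∨ v ≤ c • u)
    (hu : u' ≤ u) (hv : v ≤ v') (hcu : c • u' = u') (hcv : c • v' = v') (b : G) (N : ℕ) :
    ∑ i ∈ Finset.range N, lengthOf (b * c ^ i) u v ≤ lengthOf b u' v' := by
  have hNu : ((b • u' : Icc (0 : ℝ) 1) : ℝ) ≤ ((b * c ^ N) • u : Icc (0 : ℝ) 1) := by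
    have : u' ≤ c ^ N • u := by
      rw [← pow_smul_eq_of_smul_eq hcu N]; exact smul_mono_right _ hu
    rw [mul_smul]; exact smul_mono_right b this
  have hNv : (((b * c ^ N) • v : Icc (0 : ℝ) 1) : ℝ) ≤ (b • v' : Icc (0 : ℝ) 1) := by
    have : c ^ N • v ≤ v' := by
      conv_rhs => rw [← pow_smul_eq_of_smul_eq hcv N]
      exact smul_mono_right _ hv
    rw [mul_smul]; exact smul_mono_right b this
  have hNuv : (((b * c ^ N) • u : Icc (0 : ℝ) 1) : ℝ) ≤ ((b * c ^ N) • v : Icc (0 : ℝ) 1) :=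
    smul_mono_right _ huv
  have hbu : ((b • u' : Icc (0 : ℝ) 1) : ℝ) ≤ (b • u : Icc (0 : ℝ) 1) := smul_mono_right b hu
  have hbv : ((b • v : Icc (0 : ℝ) 1) : ℝ) ≤ (b • v' : Icc (0 : ℝ) 1) := smul_mono_right b hv
  rcases hdisj with h | h
  · have hterm : ∀ i ∈ Finset.range N, lengthOf (b * c ^ i) u v ≤
        ((((b * c ^ i) • v : Icc (0 : ℝ) 1)) : ℝ) - ((b * c ^ (i + 1)) • v : Icc (0 : ℝ) 1) := by
      intro i _
      have : (((b * c ^ (i + 1)) • v : Icc (0 : ℝ) 1) : ℝ) ≤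
          ((b * c ^ i) • u : Icc (0 : ℝ) 1) := by
        rw [pow_succ, ← mul_assoc, mul_smul (b * c ^ i) c]
        exact smul_mono_right (b * c ^ i) h
      rw [lengthOf]; linarith
    refine (Finset.sum_le_sum hterm).trans ?_
    rw [Finset.sum_range_sub' (fun i => ((((b * c ^ i) • v : Icc (0 : ℝ) 1)) : ℝ)), lengthOf]
    simp only [pow_zero, mul_one]
    linarith
  · have hterm : ∀ i ∈ Finset.range N, lengthOf (b * c ^ i) u v ≤
        ((((b * c ^ (i + 1)) • u : Icc (0 : ℝ) 1)) : ℝ) - ((b * c ^ i) • u : Icc (0 : ℝ) 1) := by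
      intro i _
      have : (((b * c ^ i) • v : Icc (0 : ℝ) 1) : ℝ) ≤
          ((b * c ^ (i + 1)) • u : Icc (0 : ℝ) 1) := by
        rw [pow_succ, ← mul_assoc, mul_smul (b * c ^ i) c]
        exact smul_mono_right (b * c ^ i) h
      rw [lengthOf]; linarith
    refine (Finset.sum_le_sum hterm).trans ?_
    rw [Finset.sum_range_sub (fun i => ((((b * c ^ i) • u : Icc (0 : ℝ) 1)) : ℝ)), lengthOf]
    simp only [pow_zero, mul_one]
    linarith

end Expands

/-! ### No leaf is expanded in a C¹ action -/

section Tower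

variable {G : Type*} [Group G]

/-- The conjugates of `a` by the positive powers of `t`. -/
def powConj (a t : G) (n : ℕ) : G := t ^ (n + 1) * a * (t ^ (n + 1))⁻¹

theorem wordProd_mem {N : Subgroup G} (hN : N.Normal) {a t : G} (ha : a ∈ N) (w : ℕ → ℕ) (n : ℕ) :
    wordProd (powConj a t) w n ∈ N := by
  induction n with
  | zero => exact N.one_mem
  | succ n ih => exact N.mul_mem (N.pow_mem (hN.conj_mem a ha _) _) ih

variable [MulAction G (Icc (0 : ℝ) 1)]
variable [CovariantClass G (Icc (0 : ℝ) 1) (· • ·) (· ≤ ·)]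
variable {N : Subgroup G} {F : Set (Icc (0 : ℝ) 1)} {a t : G} {u v α : Icc (0 : ℝ) 1}

/-- Consecutive conjugating powers of t cancel except for one t⁻¹, so each level costs one factor η
for t⁻¹ and at most η^M for the power of `a`, regardless of how high the tower is. -/
theorem expands_inv_mul_wordProd {η θ : ℝ} (hη : 0 ≤ η) (hη1 : η ≤ 1) (hθ : 0 < θ) {m : ℕ}
    (ht : ∀ k, m ≤ k → Expands α t⁻¹ (t ^ (k + 1) • u) (t ^ k • u) (η * θ⁻¹))
    (ha : ∀ k, m ≤ k → Expands α a (t ^ k • u) (t ^ k • u) η) {M : ℕ} {w : ℕ → ℕ}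
    (hw : ∀ k, w k < M) (n k : ℕ) (hk : m ≤ k) :
    Expands α ((t ^ n)⁻¹ * wordProd (powConj a t) w n) (t ^ (k + n) • u) (t ^ k • u)
      ((η ^ (M + 1)) ^ n * (θ ^ n)⁻¹) := by
  induction n generalizing k with
  | zero => simpa [wordProd] using expands_one (G := G) (t ^ k • u)
  | succ n ih =>
    have hword : (t ^ (n + 1))⁻¹ * wordProd (powConj a t) w (n + 1) =
        a ^ w n * (t⁻¹ * ((t ^ n)⁻¹ * wordProd (powConj a t) w n)) := by
      rw [wordProd, powConj, conj_pow]
      group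
    rw [hword, show k + (n + 1) = k + 1 + n by ring]
    have hpos := mul_nonneg hη (inv_nonneg.2 hθ.le)
    have h2 := ((ha k hk).pow hη (w n)).mono (pow_le_pow_of_le_one hη hη1 (hw n).le)
    have h3 := h2.mul ((ht k hk).mul (ih (k + 1) (by omega)) hpos) (pow_nonneg hη M)
    refine h3.mono (le_of_eq ?_)
    field_simp
    ring

/-- Composing with t^n cancels the derivative θ of t: only powers of η remain. -/
theorem expands_wordProd {η θ : ℝ} (hη : 0 ≤ η) (hη1 : η ≤ 1) (hθ : 0 < θ) {m : ℕ}
    (ht' : Expands α t (t ^ m • u) (t ^ m • u) (η * θ))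
    (ht : ∀ k, m ≤ k → Expands α t⁻¹ (t ^ (k + 1) • u) (t ^ k • u) (η * θ⁻¹))
    (ha : ∀ k, m ≤ k → Expands α a (t ^ k • u) (t ^ k • u) η) {M : ℕ} {w : ℕ → ℕ}
    (hw : ∀ k, w k < M) (n : ℕ) :
    Expands α (wordProd (powConj a t) w n) (t ^ (m + n) • u) (t ^ m • u) ((η ^ (M + 2)) ^ n) := by
  have h1 := ht'.pow (mul_nonneg hη hθ.le) n
  have h2 := expands_inv_mul_wordProd hη hη1 hθ ht ha hw n m le_rfl
  have h3 := h1.mul h2 (pow_nonneg (mul_nonneg hη hθ.le) n)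
  rw [mul_inv_cancel_left] at h3
  refine h3.mono (le_of_eq ?_)
  rw [mul_pow]
  field_simp
  ring

/-- In a `C¹` action, no element maps a leaf strictly over itself. -/
theorem IsLeaf.not_expanded (h : IsLeaf N F a u v) (hNF : IsAbelianOn N F)
    (hC1 : ∀ α : Icc (0 : ℝ) 1, ∃ D : G → ℝ, IsC1Action G α D) (hu : t • u < u)
    (hv : v < t • v) : False := by
  set α := sInf (range fun n : ℕ => t ^ n • u)
  have htα : t • α = α := smul_sInf_pow_smul hu
  have haα : a • α = α := h.smul_sInf_range_pow hNF hu hv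
  have hanti := strictAnti_pow_smul hu
  have hmono := strictMono_pow_smul hv
  have hun : ∀ n : ℕ, t ^ n • u ≤ u := fun n => by simpa using hanti.antitone (Nat.zero_le n)
  have hvn : ∀ n : ℕ, v ≤ t ^ n • v := fun n => by simpa using hmono.monotone (Nat.zero_le n)
  have hαu : ∀ n : ℕ, α < t ^ n • u := fun n =>
    (sInf_le (mem_range_self (n + 1))).trans_lt (hanti n.lt_succ_self)
  have hα1 : (α : ℝ) < 1 := by
    have h1 : α < ⊤ := ((hαu 0).trans_le (hun 0)).trans (h.lt.trans h.lt_top)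
    exact h1
  have hlim : ∀ δ > (0 : ℝ), ∃ n : ℕ, ((t ^ n • u : Icc (0 : ℝ) 1) : ℝ) < α + δ := by
    intro δ hδ
    have h1 : (α : ℝ) < min (α + δ) 1 := lt_min (by linarith) hα1
    have h2 : α < ⟨min (α + δ) 1, (α.2.1.trans_lt h1).le, min_le_right _ _⟩ := h1
    obtain ⟨_, ⟨n, rfl⟩, hn⟩ := sInf_lt_iff.1 h2
    exact ⟨n, lt_of_lt_of_le (show ((t ^ n • u : Icc (0 : ℝ) 1) : ℝ) < min (α + δ) 1 from hn)
      (min_le_left _ _)⟩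
  obtain ⟨D, hD⟩ := hC1 α
  have hDa : D a = 1 := hD.eq_one_of_fixed haα fun δ hδ => by
    obtain ⟨n, hn⟩ := hlim δ hδ
    exact ⟨_, hαu n, hn, h.smul_pow_smul hNF hu hv n⟩
  have hθ := hD.pos t htα
  obtain ⟨c₁, hc₁, hct⟩ := hD.exists_mul_le t
  obtain ⟨c₂, hc₂, hct'⟩ := hD.exists_mul_le t⁻¹
  obtain ⟨c₃, hc₃, hca⟩ := hD.exists_mul_le a
  obtain ⟨c₄, hc₄, hca'⟩ := hD.exists_mul_le a⁻¹
  have hc₃₄ : 0 < min c₃ c₄ := lt_min hc₃ hc₄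
  -- With η^(M+2) ≥ 1/2, this M gives M · η^(M+2) · c₁c₂ ≥ 2, beating the exponential loss (c₁c₂)^n
  -- from moving the leaf close to α.
  obtain ⟨M, hM⟩ := exists_nat_gt (4 / (c₁ * c₂))
  have hMpos : 0 < M := by
    have : (0 : ℝ) < M := lt_of_le_of_lt (by positivity) hM
    exact_mod_cast this
  -- Chosen so that Bernoulli's inequality gives η^(M+2) ≥ 1/2.
  set η : ℝ := 1 - 1 / (2 * ((M : ℝ) + 2))
  have hη0 : 0 ≤ η := by
    have : 1 / (2 * ((M : ℝ) + 2)) ≤ 1 := by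
      rw [div_le_one (by positivity)]; linarith [(Nat.cast_nonneg M : (0 : ℝ) ≤ M)]
    simp only [η]; linarith
  have hη1 : η < 1 := by
    have : 0 < 1 / (2 * ((M : ℝ) + 2)) := by positivity
    simp only [η]; linarith
  have hηM : 1 / 2 ≤ η ^ (M + 2) := by
    have h := one_add_mul_le_pow (a := η - 1) (by linarith) (M + 2)
    have h2 : (1 : ℝ) + ((M + 2 : ℕ) : ℝ) * (η - 1) = 1 / 2 := by
      simp only [η]; push_cast; field_simp; ring
    rw [h2] at h
    simpa using h
  obtain ⟨δ₁, hδ₁, hst⟩ := hD.exists_slope_le t htα η hη1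
  obtain ⟨δ₂, hδ₂, hst'⟩ := hD.exists_slope_inv_le htα hη1
  obtain ⟨δ₃, hδ₃, hsa⟩ := hD.exists_slope_le a haα η hη1
  rw [hDa, mul_one] at hsa
  obtain ⟨m, hm⟩ := hlim (min δ₁ (min δ₂ δ₃)) (lt_min hδ₁ (lt_min hδ₂ hδ₃))
  have hm' : ∀ k, m ≤ k → ∀ y : Icc (0 : ℝ) 1, y ≤ t ^ k • u →
      (y : ℝ) < α + δ₁ ∧ (y : ℝ) < α + δ₂ ∧ (y : ℝ) < α + δ₃ := by
    intro k hk y hy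
    have h1 : (y : ℝ) ≤ (t ^ m • u : Icc (0 : ℝ) 1) := hy.trans (hanti.antitone hk)
    have h2 := min_le_left δ₁ (min δ₂ δ₃)
    have h3 := (min_le_right δ₁ (min δ₂ δ₃)).trans (min_le_left _ _)
    have h4 := (min_le_right δ₁ (min δ₂ δ₃)).trans (min_le_right _ _)
    refine ⟨?_, ?_, ?_⟩ <;> linarith
  have het : Expands α t (t ^ m • u) (t ^ m • u) (η * D t) := by
    refine ⟨htα, fun x y hx hxy hy => ⟨(smul_mono_right t hy).trans ?_,
      hst x y hx hxy (hm' m le_rfl y hy).1⟩⟩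
    change t • t ^ m • u ≤ _
    rw [← mul_smul, ← pow_succ']
    exact hanti.antitone m.le_succ
  have het' : ∀ k, m ≤ k → Expands α t⁻¹ (t ^ (k + 1) • u) (t ^ k • u) (η * (D t)⁻¹) := by
    refine fun k hk => ⟨inv_smul_eq_iff.2 htα.symm, fun x y hx hxy hy =>
      ⟨(smul_mono_right t⁻¹ hy).trans (le_of_eq ?_), hst' x y hx hxy (hm' (k + 1) (by omega) y hy).2.1⟩⟩
    rw [pow_succ', mul_smul, inv_smul_smul]
  have hea : ∀ k, m ≤ k → Expands α a (t ^ k • u) (t ^ k • u) η := by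
    refine fun k hk => ⟨haα, fun x y hx hxy hy =>
      ⟨(smul_mono_right a hy).trans (h.smul_pow_smul hNF hu hv k).le,
        hsa x y hx hxy (hm' k hk y hy).2.2⟩⟩
  have huv : (0 : ℝ) < v - u := sub_pos.2 h.lt
  have hmain : ∀ n : ℕ, (M : ℝ) ^ n * ((η ^ (M + 2)) ^ n *
      (c₁ ^ (m + n + 1) * (min c₃ c₄ * (c₂ ^ (m + n + 1) * ((v : ℝ) - u))))) ≤ 1 := by
    intro n
    set k := m + n
    have hlen : ∀ e : G, (∀ x y : Icc (0 : ℝ) 1, x ≤ y →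
        min c₃ c₄ * ((y : ℝ) - x) ≤ lengthOf e x y) →
        c₁ ^ (k + 1) * (min c₃ c₄ * (c₂ ^ (k + 1) * ((v : ℝ) - u))) ≤
        lengthOf (t ^ (k + 1) * e * (t ^ (k + 1))⁻¹) u v := by
      intro e he
      have h1 := pow_mul_le_lengthOf hc₂.le hct' (k + 1) h.lt.le
      rw [inv_pow] at h1
      have h2 := he _ _ (smul_mono_right (t ^ (k + 1))⁻¹ h.lt.le)
      have h3 := pow_mul_le_lengthOf hc₁.le hct (k + 1)
        (smul_mono_right e (smul_mono_right (t ^ (k + 1))⁻¹ h.lt.le))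
      rw [lengthOf_mul, lengthOf_mul]
      refine le_trans (mul_le_mul_of_nonneg_left ?_ (pow_nonneg hc₁.le _)) h3
      exact le_trans (mul_le_mul_of_nonneg_left h1 hc₃₄.le) h2
    -- Of a conjugate of `a` and its inverse, one pushes the leaf to the left of t^k u, into the
    -- zone where words of n letters have controlled distortion.
    obtain ⟨b, hbN, hbα, hbv, hb⟩ : ∃ b ∈ N, b • α = α ∧ b • v ≤ t ^ k • u ∧
        c₁ ^ (k + 1) * (min c₃ c₄ * (c₂ ^ (k + 1) * ((v : ℝ) - u))) ≤ lengthOf b u v := by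
      have hmem := hNF.normal.conj_mem a h.mem (t ^ (k + 1))
      have hstab : (t ^ (k + 1) * a * (t ^ (k + 1))⁻¹) • α = α := by
        have htk := pow_smul_eq_of_smul_eq htα (k + 1)
        rw [mul_smul, mul_smul, inv_smul_eq_iff.2 htk.symm, haα, htk]
      rcases h.disjoint_pow hNF hu hv k with hd | hd
      · exact ⟨_, hmem, hstab, (smul_mono_right _ (hvn k)).trans hd, hlen a fun x y hxy =>
          (mul_le_mul_of_nonneg_right (min_le_left _ _)
            (sub_nonneg.2 (Subtype.coe_le_coe.2 hxy))).trans (hca x y hxy)⟩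
      · refine ⟨_, N.inv_mem hmem, inv_smul_eq_iff.2 hstab.symm, ?_, ?_⟩
        · refine (smul_mono_right _ ((hvn k).trans hd)).trans ?_
          rw [inv_smul_smul]
        · have := hlen a⁻¹ fun x y hxy =>
            (mul_le_mul_of_nonneg_right (min_le_right _ _)
              (sub_nonneg.2 (Subtype.coe_le_coe.2 hxy))).trans
              (hca' x y hxy)
          rwa [show t ^ (k + 1) * a⁻¹ * (t ^ (k + 1))⁻¹ = (t ^ (k + 1) * a * (t ^ (k + 1))⁻¹)⁻¹ by
            group] at this
    have hαb : α ≤ b • u := by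
      rw [← hbα]
      exact smul_mono_right b (by simpa using (hαu 0).le)
    refine le_trans ?_ (lengthOf_le_one b (t ^ n • u) (t ^ n • v))
    refine pow_mul_le_of_sum_le (L := fun b n => lengthOf b (t ^ n • u) (t ^ n • v))
      (c := powConj a t) (m := n) hMpos ?_ n le_rfl b ?_
    · intro j _ b
      have hI := h.smul hNF (t ^ (j + 1))
      exact sum_lengthOf_le (h.smul hNF (t ^ j)).lt.le (h.disjoint_pow hNF hu hv j)
        (hanti j.lt_succ_self).le (hmono.monotone j.le_succ) hI.smul_left hI.smul_right b M
    · intro w hw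
      -- The copies counted are b · word, while the estimate concerns word · b; the two agree on u
      -- and v because N commutes on F.
      have hTN := wordProd_mem hNF.normal (t := t) h.mem w n
      have hexp := ((expands_wordProd hη0 hη1.le hθ het het' hea hw n).2
        (b • u) (b • v) hαb (smul_mono_right b h.lt.le) hbv).2
      simp only [pow_zero, one_smul]
      refine (mul_le_mul_of_nonneg_left hb (by positivity)).trans (hexp.trans_eq ?_)
      rw [lengthOf_mul, lengthOf, lengthOf, hNF.comm _ hTN b hbN v h.right_mem,
        hNF.comm _ hTN b hbN u h.left_mem]
  have hC : 0 < c₁ ^ (m + 1) * c₂ ^ (m + 1) * min c₃ c₄ * ((v : ℝ) - u) := by positivity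
  have hbase : 2 ≤ M * η ^ (M + 2) * (c₁ * c₂) := by
    rw [div_lt_iff₀ (by positivity)] at hM
    have : (M : ℝ) * (c₁ * c₂) * (1 / 2) ≤ M * (c₁ * c₂) * η ^ (M + 2) :=
      mul_le_mul_of_nonneg_left hηM (by positivity)
    linarith
  obtain ⟨n, hn⟩ := pow_unbounded_of_one_lt
    (c₁ ^ (m + 1) * c₂ ^ (m + 1) * min c₃ c₄ * ((v : ℝ) - u))⁻¹ (one_lt_two (α := ℝ))
  have h1 := hmain n
  have h2 : (2 : ℝ) ^ n ≤ (M * η ^ (M + 2) * (c₁ * c₂)) ^ n :=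
    pow_le_pow_left₀ zero_le_two hbase n
  have h3 : (M : ℝ) ^ n * ((η ^ (M + 2)) ^ n *
      (c₁ ^ (m + n + 1) * (min c₃ c₄ * (c₂ ^ (m + n + 1) * ((v : ℝ) - u))))) =
      (M * η ^ (M + 2) * (c₁ * c₂)) ^ n *
        (c₁ ^ (m + 1) * c₂ ^ (m + 1) * min c₃ c₄ * ((v : ℝ) - u)) := by
    ring_nf
  rw [h3] at h1
  have h4 := mul_lt_mul_of_pos_right (hn.trans_le h2) hC
  rw [inv_mul_cancel₀ hC.ne'] at h4
  linarith

/-- In a `C¹` action, some element of `N` acts on `F` without fixed points. -/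
theorem IsAbelianOn.exists_free [Group.FG G] (hNF : IsAbelianOn N F)
    (hC1 : ∀ α : Icc (0 : ℝ) 1, ∃ D : G → ℝ, IsC1Action G α D) :
    ∃ a ∈ N, ∀ x ∈ F, x ∈ Ioo (⊥ : Icc (0 : ℝ) 1) ⊤ → a • x ≠ x := by
  by_contra! hcon
  obtain ⟨a, u, v, t, h, hu, hv⟩ := hNF.exists_isLeaf_expanded hcon
  exact h.not_expanded hNF hC1 hu hv

end Tower

/-! ### Non-abelian affine actions collapse no interval -/

section Rigidity

variable {G : Type*} [Group G] [MulAction G (Icc (0 : ℝ) 1)]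
variable [CovariantClass G (Icc (0 : ℝ) 1) (· • ·) (· ≤ ·)]
variable {h : Icc (0 : ℝ) 1 → ℝ} {t a : G} {l β : ℝ}

theorem map_pow_smul_of_mul (ht : ∀ x ∈ Ioo (⊥ : Icc (0 : ℝ) 1) ⊤, h (t • x) = l * h x) (n : ℕ)
    {x : Icc (0 : ℝ) 1} (hx : x ∈ Ioo (⊥ : Icc (0 : ℝ) 1) ⊤) : h (t ^ n • x) = l ^ n * h x := by
  induction n with
  | zero => simp
  | succ n ih => rw [pow_succ', mul_smul, ht _ (smul_mem_Ioo _ hx), ih, pow_succ', mul_assoc]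

theorem map_pow_smul_of_add (ha : ∀ x ∈ Ioo (⊥ : Icc (0 : ℝ) 1) ⊤, h (a • x) = h x + β) (n : ℕ)
    {x : Icc (0 : ℝ) 1} (hx : x ∈ Ioo (⊥ : Icc (0 : ℝ) 1) ⊤) : h (a ^ n • x) = h x + n * β := by
  induction n with
  | zero => simp
  | succ n ih =>
    rw [pow_succ', mul_smul, ha _ (smul_mem_Ioo _ hx), ih]; push_cast; ring

theorem map_inv_smul_of_mul (hl : l ≠ 0)
    (ht : ∀ x ∈ Ioo (⊥ : Icc (0 : ℝ) 1) ⊤, h (t • x) = l * h x)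
    {x : Icc (0 : ℝ) 1} (hx : x ∈ Ioo (⊥ : Icc (0 : ℝ) 1) ⊤) : h (t⁻¹ • x) = l⁻¹ * h x := by
  have := ht _ (smul_mem_Ioo t⁻¹ hx)
  rw [smul_inv_smul] at this
  rw [this, inv_mul_cancel_left₀ hl]

theorem map_inv_smul_of_add (ha : ∀ x ∈ Ioo (⊥ : Icc (0 : ℝ) 1) ⊤, h (a • x) = h x + β)
    {x : Icc (0 : ℝ) 1} (hx : x ∈ Ioo (⊥ : Icc (0 : ℝ) 1) ⊤) : h (a⁻¹ • x) = h x + -β := by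
  have := ha _ (smul_mem_Ioo a⁻¹ hx)
  rw [smul_inv_smul] at this
  linarith

theorem map_conj_smul (hl : l ≠ 0)
    (ht : ∀ x ∈ Ioo (⊥ : Icc (0 : ℝ) 1) ⊤, h (t • x) = l * h x)
    (ha : ∀ x ∈ Ioo (⊥ : Icc (0 : ℝ) 1) ⊤, h (a • x) = h x + β) (j : ℕ)
    {x : Icc (0 : ℝ) 1} (hx : x ∈ Ioo (⊥ : Icc (0 : ℝ) 1) ⊤) :
    h (((t ^ j)⁻¹ * a * t ^ j) • x) = h x + β / l ^ j := by
  rw [mul_smul, mul_smul, map_inv_smul_of_mul (pow_ne_zero j hl)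
    (fun y hy => map_pow_smul_of_mul ht j hy) (smul_mem_Ioo _ (smul_mem_Ioo _ hx)),
    ha _ (smul_mem_Ioo _ hx), map_pow_smul_of_mul ht j hx]
  field_simp

/-- Along the words in `a` and `t` that realize the translations by sums of `β / l ^ j`, an interval
that is collapsed by `h` and lies close to `0` is only distorted by the factors `η`. -/
theorem lengthOf_word_of_collapsed {D η R r : ℝ} {p q : Icc (0 : ℝ) 1} (hl : 2 < l) (hβ : 0 < β)
    (ht : ∀ x ∈ Ioo (⊥ : Icc (0 : ℝ) 1) ⊤, h (t • x) = l * h x)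
    (ha : ∀ x ∈ Ioo (⊥ : Icc (0 : ℝ) 1) ⊤, h (a • x) = h x + β)
    (hη0 : 0 < η) (hη1 : η ≤ 1) (hD : 0 < D)
    (hst : ∀ x y : Icc (0 : ℝ) 1, y ∈ Ioo (⊥ : Icc (0 : ℝ) 1) ⊤ → x ≤ y → h y ≤ R →
      η * D * ((y : ℝ) - x) ≤ lengthOf t x y)
    (hst' : ∀ x y : Icc (0 : ℝ) 1, y ∈ Ioo (⊥ : Icc (0 : ℝ) 1) ⊤ → x ≤ y → h y ≤ R →
      η * D⁻¹ * ((y : ℝ) - x) ≤ lengthOf t⁻¹ x y)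
    (hsa : ∀ x y : Icc (0 : ℝ) 1, y ∈ Ioo (⊥ : Icc (0 : ℝ) 1) ⊤ → x ≤ y → h y ≤ R →
      η * ((y : ℝ) - x) ≤ lengthOf a x y)
    (hq : q ∈ Ioo (⊥ : Icc (0 : ℝ) 1) ⊤) (hpq : p ≤ q) (hqr : h q = r) (hr : r ≤ 0)
    (hrR : r + 2 * β ≤ R) {w : ℕ → ℕ} (hw : ∀ k, w k < 2) {n : ℕ} (k j : ℕ) (hkj : k + j = n) :
    h ((t ^ j * wordProd (fun i => (t ^ (n - i))⁻¹ * a * t ^ (n - i)) w k) • q) ≤ l ^ j * r + β ∧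
      η ^ (n + 2 * k) * D ^ j * ((q : ℝ) - p) ≤
        lengthOf (t ^ j * wordProd (fun i => (t ^ (n - i))⁻¹ * a * t ^ (n - i)) w k) p q := by
  have hpow : ∀ j : ℕ, l ^ j * r ≤ r := fun j => by
    have : 1 ≤ l ^ j := one_le_pow₀ (by linarith)
    nlinarith
  induction k generalizing j with
  | zero =>
    obtain rfl : j = n := by omega
    simp only [wordProd, mul_one, mul_zero, add_zero]
    refine ⟨by rw [map_pow_smul_of_mul ht j hq, hqr]; linarith, ?_⟩
    clear hkj
    induction j with
    | zero => simp [lengthOf]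
    | succ j ih =>
      rw [pow_succ' t, lengthOf_mul]
      have h1 := hst (t ^ j • p) (t ^ j • q) (smul_mem_Ioo _ hq) (smul_mono_right _ hpq) (by
        rw [map_pow_smul_of_mul ht j hq, hqr]; linarith [hpow j])
      refine le_trans ?_ h1
      have h2 := mul_le_mul_of_nonneg_left ih (mul_nonneg hη0.le hD.le)
      refine le_trans (le_of_eq ?_) h2
      ring
  | succ k ih =>
    obtain ⟨h1, h2⟩ := ih (j + 1) (by omega)
    set c : ℕ → G := fun i => (t ^ (n - i))⁻¹ * a * t ^ (n - i)
    set T := t ^ (j + 1) * wordProd c w k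
    -- Each letter costs only one a-power and one t⁻¹. With the n initial powers of t, this explains
    -- the exponent n + 2k.
    have hword : t ^ j * wordProd c w (k + 1) = t⁻¹ * (a ^ w k * T) := by
      have hc : c k ^ w k = (t ^ (j + 1))⁻¹ * a ^ w k * t ^ (j + 1) := by
        have hnk : n - k = j + 1 := by omega
        have := conj_pow (i := w k) (a := (t ^ (j + 1))⁻¹) (b := a)
        simp only [c, hnk]
        simpa using this
      rw [wordProd, hc]
      simp only [T, pow_succ]
      group
    have hTp : T • p ≤ T • q := smul_mono_right T hpq
    have hTq := smul_mem_Ioo T hq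
    have hlR : h (T • q) ≤ R := by linarith [hpow (j + 1)]
    have haw : h (a ^ w k • T • q) ≤ h (T • q) + β ∧
        η * (((T • q : Icc (0 : ℝ) 1) : ℝ) - (T • p : Icc (0 : ℝ) 1)) ≤
          lengthOf (a ^ w k) (T • p) (T • q) := by
      have hlen : 0 ≤ ((T • q : Icc (0 : ℝ) 1) : ℝ) - (T • p : Icc (0 : ℝ) 1) := sub_nonneg.2 hTp
      rcases (show w k = 0 ∨ w k = 1 by have := hw k; omega) with h0 | h0
      · rw [h0, pow_zero, one_smul, lengthOf_one]
        exact ⟨by linarith, mul_le_of_le_one_left hlen hη1⟩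
      · rw [h0, pow_one, ha _ hTq]
        exact ⟨le_rfl, hsa _ _ hTq hTp hlR⟩
    have hawq := smul_mem_Ioo (a ^ w k) hTq
    have hlR' : h (a ^ w k • T • q) ≤ R := by linarith [hpow (j + 1), haw.1]
    have h3 := hst' _ _ hawq (smul_mono_right (a ^ w k) hTp) hlR'
    rw [hword]
    constructor
    -- After `a` the excess is at most 2β, and t⁻¹ divides it by l > 2, restoring the bound β.
    · rw [mul_smul, mul_smul, map_inv_smul_of_mul (by linarith) ht hawq]
      have hl0 : 0 < l := by linarith
      rw [inv_mul_le_iff₀ hl0]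
      have := haw.1
      have h4 : l * (l ^ j * r + β) = l ^ (j + 1) * r + l * β := by ring
      rw [h4]
      nlinarith
    · rw [lengthOf_mul, mul_smul (a ^ w k) T p, mul_smul (a ^ w k) T q]
      refine le_trans ?_ h3
      have h5 := mul_le_mul_of_nonneg_left (mul_le_mul_of_nonneg_left h2 hη0.le)
        (mul_nonneg hη0.le (inv_pos.2 hD).le)
      refine le_trans (le_of_eq ?_) (h5.trans
        (mul_le_mul_of_nonneg_left haw.2 (mul_nonneg hη0.le (inv_pos.2 hD).le)))
      field_simp
      ring

/-- A semi-conjugacy to a non-abelian affine action does not collapse any interval. -/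
theorem IsC1Action.strictMonoOn_of_affine {D : G → ℝ} (hD : IsC1Action G ⊥ D)
    (hmono : MonotoneOn h (Ioo ⊥ ⊤)) (hl : 2 < l) (hβ : 0 < β) (hDa : D a = 1)
    (ht : ∀ x ∈ Ioo (⊥ : Icc (0 : ℝ) 1) ⊤, h (t • x) = l * h x)
    (ha : ∀ x ∈ Ioo (⊥ : Icc (0 : ℝ) 1) ⊤, h (a • x) = h x + β) :
    StrictMonoOn h (Ioo ⊥ ⊤) := by
  intro x hx y hy hxy
  refine lt_of_le_of_ne (hmono hx hy hxy.le) fun heq => ?_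
  have hfix : ∀ g : G, g • (⊥ : Icc (0 : ℝ) 1) = ⊥ := fun g => map_bot (smulOrderIso g)
  have hlt_of : ∀ x ∈ Ioo (⊥ : Icc (0 : ℝ) 1) ⊤, ∀ y ∈ Ioo (⊥ : Icc (0 : ℝ) 1) ⊤,
      h x < h y → x < y := fun x hx y hy hxy => by
    by_contra! hle
    exact hxy.not_ge (hmono hy hx hle)
  have hη1 : (9 / 10 : ℝ) < 1 := by norm_num
  obtain ⟨δ₁, hδ₁, hst⟩ := hD.exists_slope_le t (hfix t) _ hη1
  obtain ⟨δ₂, hδ₂, hst'⟩ := hD.exists_slope_inv_le (hfix t) hη1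
  obtain ⟨δ₃, hδ₃, hsa⟩ := hD.exists_slope_le a (hfix a) _ hη1
  rw [hDa, mul_one] at hsa
  set δ := min δ₁ (min δ₂ δ₃)
  have hδ : 0 < δ := lt_min hδ₁ (lt_min hδ₂ hδ₃)
  have hmin1 := min_le_right δ 1
  have hmin2 := min_le_left δ 1
  have hmin3 : 0 < min δ 1 := lt_min hδ one_pos
  let z : Icc (0 : ℝ) 1 := ⟨min δ 1 / 2, by linarith, by linarith⟩
  have hz : z ∈ Ioo (⊥ : Icc (0 : ℝ) 1) ⊤ :=
    ⟨show (0 : ℝ) < min δ 1 / 2 by linarith, show min δ 1 / 2 < (1 : ℝ) by linarith⟩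
  -- `a⁻¹ ^ m` lowers h by mβ: enough to have h q + 2β below both h z and 0, so every interval met
  -- by the words lies within δ of the endpoint.
  obtain ⟨m, hm⟩ := exists_nat_gt ((h y - (min (h z) 0 - 3 * β)) / β)
  rw [div_lt_iff₀ hβ] at hm
  set p := a⁻¹ ^ m • x
  set q := a⁻¹ ^ m • y
  have hp : p ∈ Ioo (⊥ : Icc (0 : ℝ) 1) ⊤ := smul_mem_Ioo _ hx
  have hq : q ∈ Ioo (⊥ : Icc (0 : ℝ) 1) ⊤ := smul_mem_Ioo _ hy
  have hpq : p < q := (smul_lt_smul_iff_of_action _).2 hxy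
  have hhp : h p = h x + m * -β :=
    map_pow_smul_of_add (fun x hx => map_inv_smul_of_add ha hx) m hx
  have hhq : h q = h y + m * -β :=
    map_pow_smul_of_add (fun x hx => map_inv_smul_of_add ha hx) m hy
  have hhpq : h p = h q := by rw [hhp, hhq, heq]
  have hz1 := min_le_left (h z) 0
  have hz2 := min_le_right (h z) 0
  have hclose : ∀ y ∈ Ioo (⊥ : Icc (0 : ℝ) 1) ⊤, h y ≤ h q + 2 * β → (y : ℝ) < δ := by
    intro y hy hyR
    have h1 : (y : ℝ) < z := hlt_of y hy z hz (by linarith)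
    have h2 : (z : ℝ) = min δ 1 / 2 := rfl
    linarith
  have hbot : ((⊥ : Icc (0 : ℝ) 1) : ℝ) = 0 := rfl
  rw [hbot, zero_add] at hst hst' hsa
  have hδ₁' : δ ≤ δ₁ := min_le_left _ _
  have hδ₂' : δ ≤ δ₂ := (min_le_right _ _).trans (min_le_left _ _)
  have hδ₃' : δ ≤ δ₃ := (min_le_right _ _).trans (min_le_right _ _)
  have hl0 : l ≠ 0 := by linarith
  have hmain : ∀ n : ℕ, ((2 : ℕ) : ℝ) ^ n * ((9 / 10 : ℝ) ^ (n + 2 * n) * ((q : ℝ) - p)) ≤ 1 := by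
    intro n
    refine le_trans ?_ (lengthOf_le_one (1 : G) p (((t ^ (n - n))⁻¹ * a * t ^ (n - n)) • p))
    refine pow_mul_le_of_sum_le (N := 2)
      -- Level k is [p, s p], where s translates by β/l^(n-k). Two steps of level k fit in one of
      -- level k + 1 because l > 2, and level 0 contains the collapsed interval [p, q].
      (L := fun b k => lengthOf b p (((t ^ (n - k))⁻¹ * a * t ^ (n - k)) • p))
      (c := fun i => (t ^ (n - i))⁻¹ * a * t ^ (n - i)) (m := n) two_pos ?_ n le_rfl 1 ?_
    · intro k hk b
      obtain ⟨j, hj⟩ : ∃ j, n - k = j + 1 := ⟨n - k - 1, by omega⟩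
      have hj' : n - (k + 1) = j := by omega
      simp only [hj, hj', Finset.sum_range_succ, Finset.sum_range_zero, zero_add, pow_zero, mul_one,
        pow_one]
      set c := (t ^ (j + 1))⁻¹ * a * t ^ (j + 1)
      have hle : c • c • p ≤ ((t ^ j)⁻¹ * a * t ^ j) • p := by
        refine (hlt_of _ (smul_mem_Ioo _ (smul_mem_Ioo _ hp)) _ (smul_mem_Ioo _ hp) ?_).le
        rw [map_conj_smul hl0 ht ha _ (smul_mem_Ioo _ hp), map_conj_smul hl0 ht ha _ hp,
          map_conj_smul hl0 ht ha _ hp]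
        have hlj : 0 < l ^ j := pow_pos (by linarith) j
        have h1 : β / l ^ j = l * (β / l ^ (j + 1)) := by rw [pow_succ]; field_simp
        have h2 : 0 < β / l ^ (j + 1) := div_pos hβ (pow_pos (by linarith) _)
        rw [h1]
        nlinarith
      have hle' := lengthOf_mono b (le_refl p) hle
      simp only [lengthOf, mul_smul b c] at hle' ⊢
      linarith
    · intro w hw
      have h1 := (lengthOf_word_of_collapsed (D := D t) (R := h q + 2 * β) hl hβ ht ha
        (by norm_num) hη1.le (hD.pos t (hfix t))
        (fun x y hy hxy hyR => hst x y bot_le hxy ((hclose y hy hyR).trans_le hδ₁'))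
        (fun x y hy hxy hyR => hst' x y bot_le hxy ((hclose y hy hyR).trans_le hδ₂'))
        (fun x y hy hxy hyR => hsa x y bot_le hxy ((hclose y hy hyR).trans_le hδ₃'))
        hq hpq.le rfl (by linarith) le_rfl hw (n := n) n 0 (add_zero n)).2
      rw [pow_zero, pow_zero, mul_one, one_mul] at h1
      rw [one_mul]
      refine h1.trans (lengthOf_mono _ le_rfl (hlt_of _ hq _ (smul_mem_Ioo _ hp) ?_).le)
      rw [map_conj_smul hl0 ht ha _ hp, hhpq]
      have : 0 < β / l ^ (n - 0) := div_pos hβ (pow_pos (by linarith) _)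
      linarith
  have hC : (0 : ℝ) < q - p := sub_pos.2 hpq
  obtain ⟨n, hn⟩ := pow_unbounded_of_one_lt ((q : ℝ) - p)⁻¹ (show (1 : ℝ) < 1458 / 1000 by norm_num)
  have h1 := hmain n
  have h2 : ((2 : ℕ) : ℝ) ^ n * ((9 / 10 : ℝ) ^ (n + 2 * n) * ((q : ℝ) - p)) =
      (1458 / 1000 : ℝ) ^ n * ((q : ℝ) - p) := by
    rw [show n + 2 * n = 3 * n by ring, pow_mul, ← mul_assoc, ← mul_pow]
    norm_num
  rw [h2] at h1
  have h4 := mul_lt_mul_of_pos_right hn hC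
  rw [inv_mul_cancel₀ hC.ne'] at h4
  linarith

end Rigidity

/-! ### Locating N and F in a virtually solvable group -/

section Solvable

variable {G X : Type*} [Group G]

theorem IsVirtuallySolvable.exists_normal_chain (hG : IsVirtuallySolvable G) :
    ∃ C : ℕ → Subgroup G, (∀ n, (C n).Normal) ∧ (C 0).FiniteIndex ∧
      (∀ n, C (n + 1) = ⁅C n, C n⁆) ∧ ∃ n, C n = ⊥ := by
  obtain ⟨H, hH, hsol⟩ := hG
  have hK : Group.IsSolvable H.normalCore :=
    Group.isSolvable_of_isSolvable_injective
      (Subgroup.inclusion_injective (Subgroup.normalCore_le H))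
  obtain ⟨n, hn⟩ := (Group.isSolvable_def _).1 hK
  have h0 : (derivedSeries H.normalCore 0).map H.normalCore.subtype = H.normalCore := by
    rw [derivedSeries_zero, ← MonoidHom.range_eq_map, Subgroup.range_subtype]
  have hsucc : ∀ n, (derivedSeries H.normalCore (n + 1)).map H.normalCore.subtype =
      ⁅(derivedSeries H.normalCore n).map H.normalCore.subtype,
        (derivedSeries H.normalCore n).map H.normalCore.subtype⁆ := fun n => by
    rw [derivedSeries_succ, Subgroup.map_commutator]
  refine ⟨fun n => (derivedSeries H.normalCore n).map H.normalCore.subtype, fun n => ?_, ?_, hsucc,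
    n, ?_⟩
  · dsimp only
    induction n with
    | zero => rw [h0]; infer_instance
    | succ n ih => rw [hsucc]; exact Subgroup.commutator_normal _ _
  · dsimp only
    rw [h0]; infer_instance
  · dsimp only
    rw [hn, Subgroup.map_bot]

variable [MulAction G X] [CompleteLinearOrder X] [CovariantClass G X (· • ·) (· ≤ ·)]

/-- The G-orbit of x is finite, and an increasing action fixes its maximum. -/
theorem exists_fixed_of_finiteIndex {K : Subgroup G} (hK : K.FiniteIndex) {x : X}
    (hx : x ∈ Ioo (⊥ : X) ⊤) (hfix : ∀ g ∈ K, g • x = x) :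
    ∃ y ∈ Ioo (⊥ : X) ⊤, ∀ g : G, g • y = y := by
  have hle : K ≤ MulAction.stabilizer G x := fun g hg => hfix g hg
  have : (MulAction.stabilizer G x).FiniteIndex := Subgroup.finiteIndex_of_le hle
  have hfin : Finite (MulAction.orbit G x) :=
    Finite.of_equiv _ (MulAction.orbitEquivQuotientStabilizer G x).symm
  have : Nonempty (MulAction.orbit G x) := ⟨⟨x, MulAction.mem_orbit_self x⟩⟩
  obtain ⟨⟨y, hy⟩, hmax⟩ := Finite.exists_max fun z : MulAction.orbit G x => (z : X)
  have hle : ∀ g : G, g • y ≤ y := fun g =>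
    hmax ⟨g • y, MulAction.mem_orbit_of_mem_orbit g hy⟩
  refine ⟨y, ?_, fun g => le_antisymm (hle g) ?_⟩
  · obtain ⟨g, rfl⟩ := hy
    exact smul_mem_Ioo g hx
  · have := hle g⁻¹
    rwa [smul_le_iff_le_inv_smul, inv_inv] at this

open scoped commutatorElement in
/-- An irreducible action of a virtually solvable group has a normal subgroup whose derived
subgroup has fixed points in the interior, while the subgroup itself has none. -/
theorem IsVirtuallySolvable.exists_isAbelianOn (hG : IsVirtuallySolvable G)
    (hne : (Ioo (⊥ : X) ⊤).Nonempty) (hirr : ∀ x ∈ Ioo (⊥ : X) ⊤, ∃ g : G, g • x ≠ x) :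
    ∃ (N : Subgroup G) (F : Set X), IsAbelianOn N F ∧
      (N.FiniteIndex ∨ ∃ M : Subgroup G, N = ⁅M, M⁆) := by
  classical
  obtain ⟨C, hnormal, hfin, hsucc, m, hm⟩ := hG.exists_normal_chain
  have hex : ∃ n, ∃ x ∈ Ioo (⊥ : X) ⊤, ∀ g ∈ C n, g • x = x := by
    obtain ⟨x, hx⟩ := hne
    refine ⟨m, x, hx, fun g hg => ?_⟩
    rw [hm, Subgroup.mem_bot] at hg
    rw [hg, one_smul]
  have hzero : ¬ ∃ x ∈ Ioo (⊥ : X) ⊤, ∀ g ∈ C 0, g • x = x := by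
    rintro ⟨x, hx, hfix⟩
    obtain ⟨y, hy, hyfix⟩ := exists_fixed_of_finiteIndex hfin hx hfix
    obtain ⟨g, hg⟩ := hirr y hy
    exact hg (hyfix g)
  obtain ⟨i, hi⟩ : ∃ i, Nat.find hex = i + 1 :=
    Nat.exists_eq_succ_of_ne_zero fun h => hzero (h ▸ Nat.find_spec hex)
  have hspec := Nat.find_spec hex
  rw [hi] at hspec
  have hmin : ¬ ∃ x ∈ Ioo (⊥ : X) ⊤, ∀ g ∈ C i, g • x = x := Nat.find_min hex (by omega)
  -- F is the fixed set of `C (i + 1)`: normality makes it G-invariant, and commutators of `C i` act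
  -- trivially on it.
  refine ⟨C i, {x | ∀ g ∈ C (i + 1), g • x = x}, ⟨hnormal i, ?_, ?_, ?_, ?_, ?_, ?_⟩, ?_⟩
  · intro A hA g hg
    rw [smul_sSup_of_action, (image_congr fun x hx => hA hx g hg).trans (image_id' A)]
  · intro A hA g hg
    rw [smul_sInf_of_action, (image_congr fun x hx => hA hx g hg).trans (image_id' A)]
  · intro g x hx f hf
    have := hx _ ((hnormal (i + 1)).conj_mem f hf g⁻¹)
    rw [inv_inv, mul_smul, mul_smul, inv_smul_eq_iff] at this
    exact this
  · intro a ha b hb x hx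
    have hmem : ⁅a⁻¹, b⁻¹⁆ ∈ C (i + 1) := by
      rw [hsucc]
      exact Subgroup.commutator_mem_commutator ((C i).inv_mem ha) ((C i).inv_mem hb)
    have := hx _ hmem
    rw [commutatorElement_def, inv_inv, inv_inv, mul_smul, mul_smul, mul_smul, inv_smul_eq_iff,
      inv_smul_eq_iff] at this
    exact this.trans rfl
  · intro x _ hx
    by_contra! h
    exact hmin ⟨x, hx, h⟩
  · obtain ⟨x, hx, hfix⟩ := hspec
    exact ⟨x, hfix, hx⟩
  · cases i with
    | zero => exact Or.inl hfin
    | succ j => exact Or.inr ⟨C j, hsucc j⟩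

end Solvable

/-! ### The affine group -/

section Affine

theorem affineMap_mem_Aff {a : ℝ} (b : ℝ) (ha : 0 < a) :
    (Homeomorph.mulLeft₀ a ha.ne').trans (Homeomorph.addRight b) ∈ Aff :=
  ⟨a, b, ha, fun _ => rfl⟩

/-- The linear part `a` of `x ↦ a x + b`. -/
def linearPart (f : Aff) : ℝ := f.1 1 - f.1 0

theorem aff_apply_eq (f : Aff) (x : ℝ) : f.1 x = linearPart f * x + f.1 0 := by
  obtain ⟨a, b, -, h⟩ := f.2
  simp only [linearPart, h]
  ring

theorem linearPart_pos (f : Aff) : 0 < linearPart f := by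
  obtain ⟨a, b, ha, h⟩ := f.2
  simp only [linearPart, h]
  linarith

theorem linearPart_mul (f g : Aff) : linearPart (f * g) = linearPart f * linearPart g := by
  have h : ∀ x, (f * g).1 x = f.1 (g.1 x) := fun _ => rfl
  rw [linearPart, h, h, aff_apply_eq f, aff_apply_eq f (g.1 0), linearPart, linearPart]
  ring

theorem linearPart_one : linearPart 1 = 1 := sub_zero (1 : ℝ)

theorem linearPart_inv (f : Aff) : linearPart f⁻¹ = (linearPart f)⁻¹ := by
  have h := linearPart_mul f⁻¹ f
  rw [inv_mul_cancel, linearPart_one] at h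
  exact eq_inv_of_mul_eq_one_left h.symm

theorem linearPart_pow (f : Aff) (n : ℕ) : linearPart (f ^ n) = linearPart f ^ n := by
  induction n with
  | zero => simp [linearPart_one]
  | succ n ih => rw [pow_succ, linearPart_mul, ih, pow_succ]

theorem aff_ext_of_apply_eq {f g : Aff} {x y : ℝ} (hxy : x ≠ y) (hx : f.1 x = g.1 x)
    (hy : f.1 y = g.1 y) : f = g := by
  rw [aff_apply_eq f, aff_apply_eq g] at hx hy
  have h1 : (linearPart f - linearPart g) * (x - y) = 0 := by linear_combination hx - hy
  have h2 : linearPart f = linearPart g := by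
    rcases mul_eq_zero.1 h1 with h | h
    · linarith
    · exact absurd (sub_eq_zero.1 h) hxy
  have h3 : f.1 0 = g.1 0 := by rw [h2] at hx; linarith
  refine Subtype.ext (Homeomorph.ext fun z => ?_)
  rw [aff_apply_eq f, aff_apply_eq g, h2, h3]

variable {G X : Type*} [Group G] [TopologicalSpace X] [LinearOrder X]

/-- A function on which a group acts by affine substitutions defines an affine action. -/
theorem exists_hom_Aff {ρ : G →* Homeo₀ X} {h : X → ℝ} {x y : X} (hxy : h x ≠ h y)
    (H : ∀ g, ∃ l, 0 < l ∧ ∃ c, ∀ x, h ((ρ g).1 x) = l * h x + c) :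
    ∃ ψ : G →* Aff, ∀ g x, h ((ρ g).1 x) = (ψ g).1 (h x) := by
  choose l hl c hc using H
  let f : G → Aff := fun g => ⟨_, affineMap_mem_Aff (c g) (hl g)⟩
  have hf : ∀ g x, h ((ρ g).1 x) = (f g).1 (h x) := hc
  have hmul : ∀ g₁ g₂ x, (f (g₁ * g₂)).1 (h x) = (f g₁ * f g₂).1 (h x) := fun g₁ g₂ x => by
    change _ = (f g₁).1 ((f g₂).1 (h x))
    rw [← hf, ← hf, ← hf, map_mul]
    rfl
  exact ⟨MonoidHom.mk' f fun g₁ g₂ =>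
    aff_ext_of_apply_eq hxy (hmul g₁ g₂ x) (hmul g₁ g₂ y), hf⟩

/-- A non-abelian affine action contains an expansion and a translation that is a commutator. -/
theorem exists_expansion_of_not_isAbelianAction {ψ : G →* Aff} (hψ : ¬ IsAbelianAction ψ) :
    ∃ t u v : G, 2 < linearPart (ψ t) ∧ ∃ β ≠ 0, ∀ x, (ψ (u * v * u⁻¹ * v⁻¹)).1 x = x + β := by
  simp only [IsAbelianAction] at hψ
  push Not at hψ
  obtain ⟨_, ⟨u, rfl⟩, _, ⟨v, rfl⟩, huv⟩ := hψ
  -- Otherwise the image consists of translations, which commute.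
  have hne : ∃ g, linearPart (ψ g) ≠ 1 := by
    by_contra! h
    refine huv (Subtype.ext (Homeomorph.ext fun x => ?_))
    change (ψ u).1 ((ψ v).1 x) = (ψ v).1 ((ψ u).1 x)
    rw [aff_apply_eq (ψ u), aff_apply_eq (ψ v), aff_apply_eq (ψ v) ((ψ u).1 x), aff_apply_eq (ψ u) x, h, h]
    ring
  obtain ⟨g, hg⟩ : ∃ g, 1 < linearPart (ψ g) := by
    obtain ⟨g, hg⟩ := hne
    rcases lt_or_gt_of_ne hg with h | h
    · exact ⟨g⁻¹, by rw [map_inv, linearPart_inv]; exact (one_lt_inv₀ (linearPart_pos _)).2 h⟩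
    · exact ⟨g, h⟩
  obtain ⟨n, hn⟩ := pow_unbounded_of_one_lt 2 hg
  have hw : linearPart (ψ (u * v * u⁻¹ * v⁻¹)) = 1 := by
    simp only [map_mul, map_inv, linearPart_mul, linearPart_inv]
    have h1 := (linearPart_pos (ψ u)).ne'
    have h2 := (linearPart_pos (ψ v)).ne'
    field_simp
  refine ⟨g ^ n, u, v, by rwa [map_pow, linearPart_pow], (ψ (u * v * u⁻¹ * v⁻¹)).1 0, fun h0 => ?_,
    fun x => by rw [aff_apply_eq, hw, one_mul]⟩
  have h1 : ψ (u * v * u⁻¹ * v⁻¹) = 1 := by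
    refine Subtype.ext (Homeomorph.ext fun x => ?_)
    rw [aff_apply_eq, hw, h0, one_mul, add_zero]
    rfl
  refine huv ?_
  rw [map_mul, map_mul, map_mul, map_inv, map_inv] at h1
  rwa [mul_inv_eq_one, mul_inv_eq_iff_eq_mul] at h1

end Affine

/-! ### Dense image and the homeomorphism -/

section Homeomorph

theorem isHomeomorph_of_strictMono_of_denseRange {h : Ioo (0 : ℝ) 1 → ℝ} (hh : StrictMono h)
    (hd : DenseRange h) : IsHomeomorph h := by
  have hcont : Continuous h := hh.monotone.continuous_of_denseRange hd
  have : PreconnectedSpace (Ioo (0 : ℝ) 1) := Subtype.preconnectedSpace isPreconnected_Ioo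
  have hsurj : Function.Surjective h := fun y => by
    obtain ⟨x₁, hx₁⟩ := hd.exists_mem_open isOpen_Iio ⟨y - 1, show y - 1 < y by linarith⟩
    obtain ⟨x₂, hx₂⟩ := hd.exists_mem_open isOpen_Ioi ⟨y + 1, show y < y + 1 by linarith⟩
    exact (isPreconnected_range hcont).ordConnected.out ⟨x₁, rfl⟩ ⟨x₂, rfl⟩
      ⟨le_of_lt hx₁, le_of_lt hx₂⟩
  exact (hh.orderIsoOfSurjective h hsurj).toHomeomorph.isHomeomorph

variable {G : Type*} [Group G] [MulAction G (Icc (0 : ℝ) 1)]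
variable [CovariantClass G (Icc (0 : ℝ) 1) (· • ·) (· ≤ ·)]
variable {h : Icc (0 : ℝ) 1 → ℝ} {t a : G} {l β c : ℝ}

/-- The conjugate of `a` by t^(-j) translates h by β/l^j. Once this step is shorter than v - u,
iterates starting below u cannot jump over (u, v). -/
theorem exists_mem_Ioo_of_affine (hl : 2 < l) (hβ : 0 < β)
    (ht : ∀ x ∈ Ioo (⊥ : Icc (0 : ℝ) 1) ⊤, h (t • x) = l * h x)
    (ha : ∀ x ∈ Ioo (⊥ : Icc (0 : ℝ) 1) ⊤, h (a • x) = h x + β) {u v : ℝ} (huv : u < v) :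
    ∃ x ∈ Ioo (⊥ : Icc (0 : ℝ) 1) ⊤, h x ∈ Ioo u v := by
  obtain ⟨j, hj⟩ := pow_unbounded_of_one_lt (β / (v - u)) (show 1 < l by linarith)
  have hlj : 0 < l ^ j := pow_pos (by linarith) j
  rw [div_lt_iff₀ (sub_pos.2 huv), mul_comm, ← div_lt_iff₀ hlj] at hj
  have hε : 0 < β / l ^ j := div_pos hβ hlj
  set ε := β / l ^ j
  have hs : ∀ x ∈ Ioo (⊥ : Icc (0 : ℝ) 1) ⊤, h (((t ^ j)⁻¹ * a * t ^ j) • x) = h x + ε :=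
    fun x hx => map_conj_smul (by linarith) ht ha j hx
  set s := (t ^ j)⁻¹ * a * t ^ j
  obtain ⟨x₀, hx₀⟩ : (Ioo (⊥ : Icc (0 : ℝ) 1) ⊤).Nonempty :=
    ⟨⟨1 / 2, by norm_num, by norm_num⟩, show (0 : ℝ) < 1 / 2 by norm_num,
      show (1 / 2 : ℝ) < 1 by norm_num⟩
  obtain ⟨m, hm⟩ := exists_nat_gt ((h x₀ - u) / ε)
  rw [div_lt_iff₀ hε] at hm
  have hx₁ := smul_mem_Ioo (s⁻¹ ^ m) hx₀
  have h1 : h (s⁻¹ ^ m • x₀) = h x₀ + m * -ε :=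
    map_pow_smul_of_add (fun x hx => map_inv_smul_of_add hs hx) m hx₀
  set x₁ := s⁻¹ ^ m • x₀
  have hnn : 0 ≤ (u - h x₁) / ε := div_nonneg (by linarith) hε.le
  refine ⟨s ^ (⌊(u - h x₁) / ε⌋₊ + 1) • x₁, smul_mem_Ioo _ hx₁, ?_⟩
  rw [map_pow_smul_of_add hs _ hx₁]
  have h2 := Nat.floor_le hnn
  have h3 := Nat.lt_floor_add_one ((u - h x₁) / ε)
  rw [le_div_iff₀ hε] at h2
  rw [div_lt_iff₀ hε] at h3
  push_cast
  constructor <;> linarith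

theorem IsC1Action.strictMonoOn_and_dense_of_affine {D : G → ℝ} (hD : IsC1Action G ⊥ D)
    (hmono : MonotoneOn h (Ioo ⊥ ⊤)) (hl : 2 < l) (hβ : β ≠ 0) (hDa : D a = 1)
    (ht : ∀ x ∈ Ioo (⊥ : Icc (0 : ℝ) 1) ⊤, h (t • x) = l * h x + c)
    (ha : ∀ x ∈ Ioo (⊥ : Icc (0 : ℝ) 1) ⊤, h (a • x) = h x + β) :
    StrictMonoOn h (Ioo ⊥ ⊤) ∧ ∀ u v, u < v → ∃ x ∈ Ioo (⊥ : Icc (0 : ℝ) 1) ⊤, h x ∈ Ioo u v := by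
  wlog hβ' : 0 < β generalizing a β
  · have haβ : a • (⊥ : Icc (0 : ℝ) 1) = ⊥ := map_bot (smulOrderIso a)
    exact this (a := a⁻¹) (β := -β) (neg_ne_zero.2 hβ) (by rw [hD.map_inv haβ, hDa, inv_one])
      (fun x hx => map_inv_smul_of_add ha hx) (by
        rcases lt_or_gt_of_ne hβ with h | h
        · linarith
        · exact absurd h hβ')
  have hl1 : 1 - l ≠ 0 := by linarith
  -- c/(1 - l) is the fixed point of y ↦ l y + c; recentring there makes t act linearly.
  set k : Icc (0 : ℝ) 1 → ℝ := fun x => h x - c / (1 - l) with hk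
  have hkt : ∀ x ∈ Ioo (⊥ : Icc (0 : ℝ) 1) ⊤, k (t • x) = l * k x := fun x hx => by
    simp only [hk, ht x hx]
    field_simp
    ring
  have hka : ∀ x ∈ Ioo (⊥ : Icc (0 : ℝ) 1) ⊤, k (a • x) = k x + β := fun x hx => by
    simp only [hk, ha x hx]
    ring
  have hkmono : MonotoneOn k (Ioo ⊥ ⊤) := fun x hx y hy hxy => sub_le_sub_right (hmono hx hy hxy) _
  constructor
  · intro x hx y hy hxy
    exact (sub_lt_sub_iff_right _).1 (hD.strictMonoOn_of_affine hkmono hl hβ' hDa hkt hka hx hy hxy)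
  · intro u v huv
    obtain ⟨x, hx, h1, h2⟩ := exists_mem_Ioo_of_affine hl hβ' hkt hka
      (sub_lt_sub_right huv (c / (1 - l)))
    exact ⟨x, hx, (sub_lt_sub_iff_right _).1 h1, (sub_lt_sub_iff_right _).1 h2⟩

end Homeomorph

/-! ### The two halves of the theorem -/

section Main

variable {G : Type*} [Group G]

/-- The action on `[0,1]` defined by a homomorphism to `Diff¹₀([0,1])`. -/
abbrev actionOfHom (φ : G →* Diff₀) : MulAction G (Icc (0 : ℝ) 1) where
  smul g x := (φ g).1 x
  one_smul x := by change (φ 1).1 x = x; rw [map_one]; rfl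
  mul_smul g h x := by change (φ (g * h)).1 x = (φ g).1 ((φ h).1 x); rw [map_mul]; rfl

theorem covariantClass_actionOfHom (φ : G →* Diff₀) :
    letI := actionOfHom φ
    CovariantClass G (Icc (0 : ℝ) 1) (· • ·) (· ≤ ·) :=
  letI := actionOfHom φ
  ⟨fun g _ _ hxy => (show StrictMono (φ g).1 from (φ g).2.1).monotone hxy⟩

variable {φ : G →* Diff₀}

theorem IsIrreducibleIcc.isIrreducible_restrictAction (hφ : IsIrreducibleIcc φ) :
    IsIrreducible (restrictAction φ) := fun x => by
  obtain ⟨g, hg⟩ := hφ ⟨x, Ioo_subset_Icc_self x.2⟩ x.2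
  exact ⟨g, fun h => hg (Subtype.ext (congrArg (fun y : Ioo (0 : ℝ) 1 => (y : ℝ)) h))⟩

theorem exists_isSemiconjugacy [Group.FG G] (hG : IsVirtuallySolvable G)
    (hφ : IsIrreducibleIcc φ) : ∃ (ψ : G →* Aff) (h : Ioo (0 : ℝ) 1 → ℝ),
      IsSemiconjugacy (restrictAction φ) (affineAction ψ) h := by
  let _ := actionOfHom φ
  have := covariantClass_actionOfHom φ
  have hmid : (⟨1 / 2, by norm_num, by norm_num⟩ : Icc (0 : ℝ) 1) ∈ Ioo (⊥ : Icc (0 : ℝ) 1) ⊤ :=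
    ⟨show (0 : ℝ) < 1 / 2 by norm_num, show (1 / 2 : ℝ) < 1 by norm_num⟩
  obtain ⟨N, F, hNF, hN⟩ := hG.exists_isAbelianOn (X := Icc (0 : ℝ) 1) ⟨_, hmid⟩ hφ
  obtain ⟨a, haN, ha⟩ := hNF.exists_free fun α => ⟨_, isC1Action_of_hom φ (fun _ _ => rfl) α⟩
  obtain ⟨h, hmono, haff, b, c, hc, hb⟩ := hNF.exists_affine haN ha hN
  let k : Ioo (0 : ℝ) 1 → ℝ := fun x => h ⟨x, Ioo_subset_Icc_self x.2⟩
  have hb' : ∀ x, k ((restrictAction φ b).1 x) = k x + c := fun x => hb _ x.2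
  obtain ⟨ψ, hψ⟩ := exists_hom_Aff (ρ := restrictAction φ) (h := k)
    (x := (restrictAction φ b).1 ⟨_, hmid⟩) (y := ⟨_, hmid⟩) (by rw [hb']; simpa using hc)
    (fun g => by
      obtain ⟨l, hl, c, H⟩ := haff g
      exact ⟨l, hl, c, fun x => H _ x.2⟩)
  refine ⟨ψ, k, hφ.isIrreducible_restrictAction, fun y => ?_,
    Or.inl fun x y hxy => hmono x.2 y.2 hxy, hψ⟩
  -- Irreducibility of ψ: `ψ b` agrees with the translation by c at the distinct values k x₀ and k
  -- x₁, hence everywhere, so it has no fixed point.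
  let x₀ : Ioo (0 : ℝ) 1 := ⟨_, hmid⟩
  let x₁ := (restrictAction φ b).1 x₀
  have e0 := (hψ b x₀).symm.trans (hb' x₀)
  have e1 := (hψ b x₁).symm.trans (hb' x₁)
  rw [aff_apply_eq] at e0 e1
  have h01 : k x₁ = k x₀ + c := hb' x₀
  have h1 : (linearPart (ψ b) - 1) * c = 0 := by
    rw [h01] at e1
    linear_combination e1 - e0
  have h2 : linearPart (ψ b) = 1 := by
    rcases mul_eq_zero.1 h1 with h | h
    · linarith
    · exact absurd h hc
  refine ⟨b, ?_⟩
  change (ψ b).1 y ≠ y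
  rw [aff_apply_eq, h2]
  rw [h2] at e0
  intro h
  exact hc (by linarith)

theorem isHomeomorph_of_monotone {h : Ioo (0 : ℝ) 1 → ℝ}
    (hmono : Monotone h) {t u v : G} {l c β : ℝ} (hl : 2 < l) (hβ : β ≠ 0)
    (ht : ∀ x, h ((restrictAction φ t).1 x) = l * h x + c)
    (ha : ∀ x, h ((restrictAction φ (u * v * u⁻¹ * v⁻¹)).1 x) = h x + β) : IsHomeomorph h := by
  classical
  let _ := actionOfHom φ
  have := covariantClass_actionOfHom φ
  let H : Icc (0 : ℝ) 1 → ℝ := fun x => if hx : (x : ℝ) ∈ Ioo (0 : ℝ) 1 then h ⟨x, hx⟩ else 0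
  have hH : ∀ (x : Icc (0 : ℝ) 1) (hx : x ∈ Ioo (⊥ : Icc (0 : ℝ) 1) ⊤), H x = h ⟨x, hx⟩ :=
    fun x hx => dif_pos (show (x : ℝ) ∈ Ioo (0 : ℝ) 1 from hx)
  have hD : IsC1Action G (⊥ : Icc (0 : ℝ) 1) _ := isC1Action_of_hom φ (fun _ _ => rfl) ⊥
  set D : G → ℝ := fun g => slopeAt ⊥ (φ g).1
  have hfix : ∀ g : G, g • (⊥ : Icc (0 : ℝ) 1) = ⊥ := fun g => map_bot (smulOrderIso g)
  -- Every element fixes the endpoint 0, so D is multiplicative on all of G and trivial on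
  -- commutators.
  have hDa : D (u * v * u⁻¹ * v⁻¹) = 1 := by
    rw [hD.map_mul _ _ (hfix _), hD.map_mul _ _ (hfix _), hD.map_mul _ _ (hfix _),
      hD.map_inv (hfix _), hD.map_inv (hfix _)]
    have h1 := (hD.pos u (hfix _)).ne'
    have h2 := (hD.pos v (hfix _)).ne'
    field_simp
  obtain ⟨hstrict, hdense⟩ := hD.strictMonoOn_and_dense_of_affine (h := H) (t := t) (c := c)
    (fun x hx y hy hxy => by rw [hH x hx, hH y hy]; exact hmono hxy) hl hβ hDa
    (fun x hx => by rw [hH _ (smul_mem_Ioo t hx), hH x hx]; exact ht ⟨x, hx⟩)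
    (fun x hx => by rw [hH _ (smul_mem_Ioo _ hx), hH x hx]; exact ha ⟨x, hx⟩)
  refine isHomeomorph_of_strictMono_of_denseRange (fun x y hxy => ?_)
    (dense_of_exists_between fun {u v} huv => ?_)
  · have := hstrict (a := ⟨x, Ioo_subset_Icc_self x.2⟩) x.2
      (b := ⟨y, Ioo_subset_Icc_self y.2⟩) y.2 hxy
    rwa [hH _ x.2, hH _ y.2] at this
  · obtain ⟨x, hx, h1⟩ := hdense u v huv
    rw [hH x hx] at h1
    exact ⟨_, ⟨_, rfl⟩, h1⟩

theorem IsSemiconjugacy.isHomeomorph_of_not_isAbelianAction {ψ : G →* Aff}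
    {h : Ioo (0 : ℝ) 1 → ℝ} (hh : IsSemiconjugacy (restrictAction φ) (affineAction ψ) h)
    (hψ : ¬ IsAbelianAction ψ) : IsHomeomorph h := by
  obtain ⟨t, u, v, hl, β, hβ, ha⟩ := exists_expansion_of_not_isAbelianAction hψ
  have ht : ∀ x, h ((restrictAction φ t).1 x) = linearPart (ψ t) * h x + (ψ t).1 0 := fun x =>
    (hh.equivariant t x).trans (aff_apply_eq (ψ t) _)
  have ha' : ∀ x, h ((restrictAction φ (u * v * u⁻¹ * v⁻¹)).1 x) = h x + β := fun x =>
    (hh.equivariant _ x).trans (ha _)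
  rcases hh.monotone with hm | hm
  · exact isHomeomorph_of_monotone hm hl hβ ht ha'
  · have hneg : IsHomeomorph fun x => -h x :=
      isHomeomorph_of_monotone (φ := φ) (c := -(ψ t).1 0) (β := -β) (fun x y hxy => neg_le_neg (hm hxy))
        hl (neg_ne_zero.2 hβ) (fun x => by rw [ht]; ring) (fun x => by rw [ha']; ring)
    have := (Homeomorph.neg ℝ).isHomeomorph.comp hneg
    simpa [Function.comp_def] using this

end Main

end AffineActions
theorem theoremA {G : Type*} [Group G] [Group.FG G]
    (hG : AffineActions.IsVirtuallySolvable G)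
    (φ : G →* AffineActions.Diff₀) (hφ : AffineActions.IsIrreducibleIcc φ) :
    (∃ (ψ : G →* AffineActions.Aff) (h : Ioo (0 : ℝ) 1 → ℝ),
      AffineActions.IsSemiconjugacy (AffineActions.restrictAction φ)
        (AffineActions.affineAction ψ) h) ∧
    (∀ (ψ : G →* AffineActions.Aff) (h : Ioo (0 : ℝ) 1 → ℝ),
      AffineActions.IsSemiconjugacy (AffineActions.restrictAction φ)
        (AffineActions.affineAction ψ) h →
      ¬ AffineActions.IsAbelianAction ψ →
      AffineActions.IsConjugacy (AffineActions.restrictAction φ)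
        (AffineActions.affineAction ψ) h) := by
  exact ⟨AffineActions.exists_isSemiconjugacy hG hφ, fun ψ h hh hψ =>
    ⟨hh, hh.isHomeomorph_of_not_isAbelianAction hψ⟩⟩
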